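/- **Setting.** Let $E_1,\dots,E_N$ be finite-dimensional real inner product spaces (for example $\mathbb R^{n_i}$, or $\mathbb C^{n_i}$ with $\langle a,b\rangle=\Re(a^Hb)$), and let $E=E_1\times\dots\times E_N$ carry the Euclidean inner product. Let $\mathcal X_i\subseteq E_i$, $\mathcal X=\mathcal X_1\times\dots\times\mathcal X_N$. Let $\boldsymbol\xi$ be a random variable with values in a measurable space $\mathcal D$, and let $f_1,\dots,f_M$ be real functions of $(\mathbf x,\xi)\in\mathcal X\times\mathcal D$ such that $\sum_j f_j(\mathbf x,\boldsymbol\xi)$ is integrable for every $\mathbf x\in\mathcal X$. Consider the problem $$\min_{\mathbf x\in\mathcal X}\;U(\mathbf x),\qquad U(\mathbf x)=\mathbb E\Big[\sum_{j=1}^M f_j(\mathbf x,\boldsymbol\xi)\Big].$$ Gradients are taken relative to $\mathcal X$ and with respect to the real inner product, i.e. $h(\mathbf y)=h(\mathbf x)+\langle\nabla h(\mathbf x),\mathbf y-\mathbf x\rangle+o(\|\mathbf y-\mathbf x\|)$ for $\mathbf y\in\mathcal X$, $\mathbf y\to\mathbf x$; $\nabla_i h$ is the $i$-th block of $\nabla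 h$. A point $\mathbf z\in\mathcal X$ is *stationary* if $\langle\nabla U(\mathbf z),\mathbf y-\mathbf z\rangle\ge 0$ for all $\mathbf y\in\mathcal X$. **Algorithm.** Given $\boldsymbol\tau=(\tau_i)_i$, stepsizes $\gamma^t\in(0,1]$ $(t\ge1)$ and $\rho^t\in(0,1]$ $(t\ge 0)$ with $\rho^0=1$, samples $\boldsymbol\xi^0,\boldsymbol\xi^1,\dots\in\mathcal D$, and $\mathbf x^0\in\mathcal X$, for $t=0,1,\dots$ and every $i$: choose any set $\mathcal C_i^t\subseteq\{1,\dots,M\}$ such that $f_j(\bullet,\mathbf x_{-i}^t,\boldsymbol\xi^t)$ is convex on $\mathcal X_i$ for all $j\in\mathcal C_i^t$, put $\boldsymbol\pi_i^t=\sum_{j\notin\mathcal C_i^t}\nabla_i f_j(\mathbf x^t,\boldsymbol\xi^t)$, and set $$\hat{\mathbf x}_i^t=\operatorname*{arg\,min}_{\mathbf x_i\in\mathcal X_i}\Big\{\rho^t\sum_{j\in\mathcal C_i^t}f_j(\mathbf x_i,\mathbf x_{-i}^t,\boldsymbol\xi^t)+\rho^t\langle\mathbf x_i-\mathbf x_i^t,\boldsymbol\pi_i^t\rangle+(1-\rho^t)\langle\mathbf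 x_i-\mathbf x_i^t,\mathbf f_i^{t-1}\rangle+\tau_i\|\mathbf x_i-\mathbf x_i^t\|^2\Big\},$$ $$\mathbf x_i^{t+1}=(1-\gamma^{t+1})\mathbf x_i^t+\gamma^{t+1}\hat{\mathbf x}_i^t,\qquad \mathbf f_i^t=(1-\rho^t)\mathbf f_i^{t-1}+\rho^t\Big(\boldsymbol\pi_i^t+\sum_{j\in\mathcal C_i^t}\nabla_i f_j(\mathbf x^t,\boldsymbol\xi^t)\Big)$$ ($\mathbf f^{-1}$ is irrelevant since $\rho^0=1$). The stepsizes may be deterministic or random. Let $\mathcal F^t$ be the $\sigma$-algebra generated by $\mathbf x^0,\dots,\mathbf x^{t-1},\boldsymbol\xi^0,\dots,\boldsymbol\xi^{t-1},\gamma^1,\dots,\gamma^t,\rho^0,\dots,\rho^t$. **Theorem.** Assume: (a) each $\mathcal X_i$ is compact and convex; (b) for every $\xi\in\mathcal D$, each $f_j(\bullet,\xi)$ is differentiable on $\mathcal X$ and its gradient is Lipschitz continuous on $\mathcal X$ with constant $L_{\nabla f_j(\xi)}$; $U$ is differentiable on $\mathcal X$ with Lipschitz continuous gradient; (c) the errors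 $\mathbf e^t=\nabla U(\mathbf x^t)-\sum_j\nabla f_j(\mathbf x^t,\boldsymbol\xi^t)$ are square-integrable, $\mathbb E[\mathbf e^t\mid\mathcal F^t]=\mathbf 0$ almost surely for every $t\ge0$, and almost surely $\sup_{t\ge0}\mathbb E[\|\mathbf e^t\|^2\mid\mathcal F^t]<\infty$. Suppose that $\tau_i>0$ for all $i$ and that, almost surely, i) $\gamma^t\to0$, $\sum_t\gamma^t=\infty$, $\sum_t(\gamma^t)^2<\infty$; ii) $\rho^t\to0$, $\sum_t\rho^t=\infty$, $\sum_t(\rho^t)^2<\infty$; iii) $\gamma^t/\rho^t\to0$; iv) $\rho^t\sum_{j}L_{\nabla f_j(\boldsymbol\xi^t)}\to0$. Then almost surely the sequence $\{\mathbf x^t\}$ has at least one limit point, and every limit point of it is a stationary point of the problem. -/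

import Mathlib

open MeasureTheory Filter Topology Set

noncomputable section

namespace StochSCA

/-- The joint space `E₁ × ⋯ × E_N` with the Euclidean (`ℓ²`) inner product and norm.  Each `E i` is
a finite-dimensional real inner product space, for instance `ℝⁿ`, or `ℂⁿ` with the real inner
product `⟨a, b⟩ = Re (aᴴ b)`. -/
abbrev Joint {N : ℕ} (E : Fin N → Type*) := PiLp 2 E

/-- The joint feasible set `X₁ × ⋯ × X_N`. -/
def feasible {N : ℕ} {E : Fin N → Type*} (X : ∀ i, Set (E i)) : Set (Joint E) :=
  {x | ∀ i, x i ∈ X i}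

/-- The point `(z, x_{-i})`: the `i`-th block of `x` is replaced by `z`. -/
def withBlock {N : ℕ} {E : Fin N → Type*} (x : Joint E) (i : Fin N) (z : E i) : Joint E :=
  WithLp.toLp 2 (Function.update (fun k => x k) i z)

/-- The objective `U(x) = 𝔼[∑ⱼ fⱼ(x, ξ)]`, where `ξ` has law `ν`. -/
def objective {N M : ℕ} {E : Fin N → Type*} {Ξ : Type*} [MeasurableSpace Ξ] (ν : Measure Ξ)
    (f : Fin M → Joint E → Ξ → ℝ) (x : Joint E) : ℝ :=
  ∫ s, ∑ j, f j x s ∂ν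

/-- `z` is a stationary point of minimizing over the convex set `K` a function with gradient
field `g`: it is feasible and `⟨∇U(z), y - z⟩ ≥ 0` for all feasible `y`. -/
def IsStationary {H : Type*} [NormedAddCommGroup H] [InnerProductSpace ℝ H]
    (K : Set H) (g : H → H) (z : H) : Prop :=
  z ∈ K ∧ ∀ y ∈ K, 0 ≤ inner ℝ (g z) (y - z)

section Algorithm

variable {N M : ℕ} {E : Fin N → Type*} [∀ i, NormedAddCommGroup (E i)]
  [∀ i, InnerProductSpace ℝ (E i)] {Ξ : Type*}

/-- The pricing vector `πᵢ(x, ξ) = ∑_{j ∉ C} ∇ᵢ fⱼ(x, ξ)`; `gradf j x s` is `∇fⱼ(x, s)`. -/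
def pricing (gradf : Fin M → Joint E → Ξ → Joint E) (C : Finset (Fin M)) (x : Joint E) (s : Ξ)
    (i : Fin N) : E i :=
  ∑ j ∈ Cᶜ, gradf j x s i

/-- The convex approximation `f̂ᵢ(z; x, s)` minimized by user `i`, where `r` is the current value of
the averaging stepsize, `C` the set of functions that are not linearized, and `a` the previous
accumulation vector of user `i`. -/
def approx (f : Fin M → Joint E → Ξ → ℝ) (gradf : Fin M → Joint E → Ξ → Joint E)
    (C : Finset (Fin M)) (τ : ℝ) (r : ℝ) (x : Joint E) (s : Ξ) (i : Fin N) (a : E i) (z : E i) :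
    ℝ :=
  r * ∑ j ∈ C, f j (withBlock x i z) s
    + r * inner ℝ (z - x i) (pricing gradf C x s i)
    + (1 - r) * inner ℝ (z - x i) a
    + τ * ‖z - x i‖ ^ 2

/-- One realization of the parallel stochastic decomposition algorithm.

`C t i` is the set of functions which user `i` does not linearize at iteration `t`; each of them
has to be convex in block `i` when the other blocks are frozen at `x t`.  `xhat t` is the vector of
the best responses at iteration `t`.  The accumulation vectors are shifted by one: `acc t` is
`f^{t-1}`, so that `acc 0` is the (irrelevant, as `ρ 0 = 1`) initial value `f^{-1}`. -/
structure IsRun (X : ∀ i, Set (E i)) (f : Fin M → Joint E → Ξ → ℝ)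
    (gradf : Fin M → Joint E → Ξ → Joint E) (τ : Fin N → ℝ) (γ ρ : ℕ → ℝ) (ξ : ℕ → Ξ)
    (C : ℕ → Fin N → Finset (Fin M)) (x xhat acc : ℕ → Joint E) : Prop where
  init : x 0 ∈ feasible X
  rho_zero : ρ 0 = 1
  rho_mem : ∀ t, ρ t ∈ Ioc (0 : ℝ) 1
  gamma_mem : ∀ t, γ (t + 1) ∈ Ioc (0 : ℝ) 1
  convex_kept : ∀ t i, ∀ j ∈ C t i, ConvexOn ℝ (X i) (fun z => f j (withBlock (x t) i z) (ξ t))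
  best_response_mem : ∀ t i, xhat t i ∈ X i
  best_response_min : ∀ t i,
    IsMinOn (approx f gradf (C t i) (τ i) (ρ t) (x t) (ξ t) i (acc t i)) (X i) (xhat t i)
  update : ∀ t i, x (t + 1) i = (1 - γ (t + 1)) • x t i + γ (t + 1) • xhat t i
  accumulate : ∀ t i, acc (t + 1) i = (1 - ρ t) • acc t i
    + ρ t • (pricing gradf (C t i) (x t) (ξ t) i + ∑ j ∈ C t i, gradf j (x t) (ξ t) i)

/-- The error `∇U(x) - ∑ⱼ ∇fⱼ(x, s)` of the instantaneous gradient. -/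
def gradError (gradf : Fin M → Joint E → Ξ → Joint E) (gradU : Joint E → Joint E) (x : Joint E)
    (s : Ξ) : Joint E :=
  gradU x - ∑ j, gradf j x s

end Algorithm

/-- The history `𝓕ᵗ`: the σ-algebra generated by `x⁰, …, xᵗ⁻¹`, `ξ⁰, …, ξᵗ⁻¹`, `γ¹, …, γᵗ` and
`ρ⁰, …, ρᵗ`. -/
abbrev history {Ω H Ξ : Type*} [MeasurableSpace H] [MeasurableSpace Ξ]
    (x : ℕ → Ω → H) (ξ : ℕ → Ω → Ξ) (γ ρ : ℕ → Ω → ℝ) (t : ℕ) : MeasurableSpace Ω :=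
  (⨆ s ∈ Iio t, MeasurableSpace.comap (x s) inferInstance)
    ⊔ (⨆ s ∈ Iio t, MeasurableSpace.comap (ξ s) inferInstance)
    ⊔ (⨆ s ∈ Icc 1 t, MeasurableSpace.comap (γ s) inferInstance)
    ⊔ (⨆ s ∈ Iic t, MeasurableSpace.comap (ρ s) inferInstance)

end StochSCA

end

/-! The averaged vector `acc (t + 1)` asymptotically tracks `∇U(x t)`. Its error splits as `a (t +
1) + b t`: the noise part `a` is a weighted average of the gradient errors alone, and the drift part
`b` is caused only by the motion of `x`. Both forget the past at rate `ρ`. The drift vanishes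
because the motion per step, of order `γ`, is negligible against `ρ`. For the noise, orthogonality
of martingale increments gives an energy balance for `‖a‖²`; it yields `∑ ρ‖a‖² < ∞` and convergence
of `‖a‖²`, and `∑ ρ = ∞` forces the limit to be zero (`noiseAverage_convergence`).

The remainder is deterministic, path by path. Put `Δ = xhat - x`. Comparing the surrogate at `xhat`
and at `x` makes `Δ` a descent direction for `acc`. The Lyapunov function `U(x) + ‖b‖²` then
decreases up to summable errors, so `∑ γ‖Δ‖² < ∞` (`summable_mul_norm_sq_of_descent`). Since `∑ γ =
∞`, this alone gives only `liminf ‖Δ‖ = 0`. The best response is Lipschitz in `x` up to vanishing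
errors, so `‖Δ‖` cannot change without `γ` mass being spent, and the whole sequence tends to zero
(`tendsto_zero_of_summable_mul_sq`). The optimality conditions of the subproblems then pass to the
limit and give stationarity. -/

/-! ### Real sequences: contraction, descent and slow variation. -/

/-- Once `ε ≤ η`, the excess `max (u - η) 0` shrinks by a factor `1 - ρ ≤ exp (-ρ)` at each step,
and these factors multiply to zero. -/
theorem tendsto_zero_of_le_contraction {u ρ ε : ℕ → ℝ} (hu : ∀ t, 0 ≤ u t)
    (hρ0 : ∀ t, 0 ≤ ρ t) (hρ1 : ∀ t, ρ t ≤ 1)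
    (hρ : Tendsto (fun n => ∑ t ∈ Finset.range n, ρ t) atTop atTop)
    (hε : Tendsto ε atTop (𝓝 0))
    (h : ∀ t, u (t + 1) ≤ (1 - ρ t) * u t + ρ t * ε t) :
    Tendsto u atTop (𝓝 0) := by
  have key : ∀ η > 0, ∀ᶠ t in atTop, u t ≤ 2 * η := by
    intro η hη
    obtain ⟨T, hT⟩ := eventually_atTop.1 (hε.eventually_le_const hη)
    set v : ℕ → ℝ := fun t => max (u t - η) 0 with hv
    have hstep : ∀ t ≥ T, v (t + 1) ≤ Real.exp (-ρ t) * v t := by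
      intro t ht
      have h1 : 1 - ρ t ≤ Real.exp (-ρ t) := by
        have := Real.add_one_le_exp (-ρ t); linarith
      have h2 : v (t + 1) ≤ (1 - ρ t) * v t := by
        refine max_le ?_ (mul_nonneg (sub_nonneg.2 (hρ1 t)) (le_max_right _ _))
        have h3 := h t
        have h4 := mul_le_mul_of_nonneg_left (hT t ht) (hρ0 t)
        have h5 := mul_le_mul_of_nonneg_left (le_max_left (u t - η) 0) (sub_nonneg.2 (hρ1 t))
        simp only [hv]
        linarith
      exact h2.trans (mul_le_mul_of_nonneg_right h1 (le_max_right _ _))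
    have hbound : ∀ n ≥ T, v n ≤ Real.exp (∑ t ∈ Finset.range T, ρ t) * v T *
        Real.exp (-∑ t ∈ Finset.range n, ρ t) := by
      intro n hn
      induction n, hn using Nat.le_induction with
      | base =>
        rw [mul_right_comm, ← Real.exp_add]; simp
      | succ n hn ih =>
        refine (hstep n hn).trans ?_
        rw [Finset.sum_range_succ, neg_add, Real.exp_add]
        have := mul_le_mul_of_nonneg_left ih (Real.exp_pos (-ρ n)).le
        linarith
    have hlim : Tendsto (fun n => Real.exp (∑ t ∈ Finset.range T, ρ t) * v T *
        Real.exp (-∑ t ∈ Finset.range n, ρ t)) atTop (𝓝 0) := by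
      have := (Real.tendsto_exp_neg_atTop_nhds_zero.comp hρ).const_mul
        (Real.exp (∑ t ∈ Finset.range T, ρ t) * v T)
      simpa using this
    filter_upwards [hlim.eventually_le_const hη, eventually_ge_atTop T] with n hn hnT
    have := (le_max_left (u n - η) 0).trans ((hbound n hnT).trans hn)
    linarith
  rw [Metric.tendsto_atTop]
  intro ε' hε'
  obtain ⟨N, hN⟩ := eventually_atTop.1 (key (ε' / 4) (by positivity))
  refine ⟨N, fun n hn => ?_⟩
  rw [Real.dist_eq, sub_zero, abs_of_nonneg (hu n)]
  linarith [hN n hn]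

theorem eq_zero_of_summable_mul_of_tendsto {ρ v : ℕ → ℝ} {ℓ : ℝ} (hρ0 : ∀ t, 0 ≤ ρ t)
    (hv : ∀ t, 0 ≤ v t)
    (hρ : Tendsto (fun n => ∑ t ∈ Finset.range n, ρ t) atTop atTop)
    (hs : Summable fun t => ρ t * v t) (hℓ : Tendsto v atTop (𝓝 ℓ)) : ℓ = 0 := by
  by_contra hne
  have hpos : 0 < ℓ := lt_of_le_of_ne (ge_of_tendsto' hℓ hv) (Ne.symm hne)
  refine (not_summable_iff_tendsto_nat_atTop_of_nonneg hρ0).2 hρ ?_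
  refine summable_of_isBigO_nat hs (Asymptotics.IsBigO.of_bound (2 / ℓ) ?_)
  filter_upwards [hℓ.eventually_const_le (half_lt_self hpos)] with t ht
  rw [Real.norm_of_nonneg (hρ0 t), Real.norm_of_nonneg (mul_nonneg (hρ0 t) (hv t))]
  have h1 : 1 ≤ 2 / ℓ * v t := by
    rw [div_mul_eq_mul_div, le_div_iff₀ hpos]; linarith
  calc ρ t = ρ t * 1 := (mul_one _).symm
    _ ≤ ρ t * (2 / ℓ * v t) := mul_le_mul_of_nonneg_left h1 (hρ0 t)
    _ = _ := by ring

theorem summable_of_eventually_descent {Φ p q : ℕ → ℝ} {m : ℝ} (hp : ∀ t, 0 ≤ p t)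
    (hq0 : ∀ t, 0 ≤ q t) (hq : Summable q) (hm : ∀ t, m ≤ Φ t)
    (h : ∀ᶠ t in atTop, Φ (t + 1) ≤ Φ t - p t + q t) : Summable p := by
  obtain ⟨T, hT⟩ := eventually_atTop.1 h
  rw [← summable_nat_add_iff T]
  refine summable_of_sum_range_le (c := Φ T - m + ∑' t, q (t + T)) (fun t => hp _) fun n => ?_
  have hq' : Summable fun t => q (t + T) := (summable_nat_add_iff T).2 hq
  have h1 : ∀ n, ∑ t ∈ Finset.range n, p (t + T) ≤
      Φ T - Φ (n + T) + ∑ t ∈ Finset.range n, q (t + T) := by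
    intro n
    induction n with
    | zero => simp
    | succ n ih =>
      rw [Finset.sum_range_succ, Finset.sum_range_succ]
      have := hT (n + T) (by omega)
      rw [show n + 1 + T = n + T + 1 by ring]
      linarith
  have h2 := hq'.sum_le_tsum (Finset.range n) (fun t _ => hq0 _)
  linarith [h1 n, hm (n + T)]

/-- If `u n ≥ ε` at a late time, `u` stays above `ε / 2` until a fixed amount `c` of `γ` mass has
been spent, which costs `c (ε / 2)²` in the tail of a convergent series. -/
theorem tendsto_zero_of_summable_mul_sq {γ u η : ℕ → ℝ} {K : ℝ} (hK : 0 ≤ K)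
    (hγ0 : ∀ t, 0 ≤ γ t)
    (hγs : Tendsto (fun n => ∑ t ∈ Finset.range n, γ t) atTop atTop)
    (hu : ∀ t, 0 ≤ u t) (hs : Summable fun t => γ t * u t ^ 2) (hη : Tendsto η atTop (𝓝 0))
    (h : ∀ s t, s ≤ t → u s ≤ u t + K * ∑ r ∈ Finset.Ico s t, γ r + η s + η t) :
    Tendsto u atTop (𝓝 0) := by
  rw [Metric.tendsto_atTop]
  intro ε hε
  -- With this choice `K * c ≤ ε / 8`; together with two values of `η`, each at most `ε / 8`, the
  -- loss stays below `ε / 2`. The `+ 1` covers `K = 0`.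
  set c : ℝ := ε / (8 * (K + 1)) with hc
  have hc0 : 0 < c := by positivity
  have hKc : K * (2 * c) ≤ ε / 4 := by
    rw [hc, show K * (2 * (ε / (8 * (K + 1)))) = ε / 4 * (K / (K + 1)) by field_simp; ring]
    have : K / (K + 1) ≤ 1 := by rw [div_le_one (by positivity)]; linarith
    nlinarith
  have hCauchy := hs.hasSum.tendsto_sum_nat.cauchySeq
  rw [Metric.cauchySeq_iff] at hCauchy
  obtain ⟨N₁, hN₁⟩ := hCauchy (c * (ε / 2) ^ 2) (by positivity)
  obtain ⟨N₃, hN₃⟩ := eventually_atTop.1 (hη.eventually_le_const (show 0 < ε / 8 by positivity))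
  refine ⟨max N₁ N₃, fun n hn => ?_⟩
  have hn1 : N₁ ≤ n := (le_max_left _ _).trans hn
  have hn3 : N₃ ≤ n := (le_max_right _ _).trans hn
  rw [Real.dist_eq, sub_zero, abs_of_nonneg (hu n)]
  by_contra! hcon
  have hex : ∃ m, n ≤ m ∧ c ≤ ∑ r ∈ Finset.Ico n m, γ r := by
    obtain ⟨m, hm1, hm2⟩ := ((hγs.eventually_ge_atTop (c + ∑ t ∈ Finset.range n, γ t)).and
      (eventually_ge_atTop n)).exists
    exact ⟨m, hm2, by rw [Finset.sum_Ico_eq_sub _ hm2]; linarith⟩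
  classical
  -- First time the mass spent since `n` reaches `c`: before `m` it is below `c`, so `u` stays large
  -- there, while up to `m` it is enough for the contradiction.
  set m := Nat.find hex with hm
  obtain ⟨hnm, hcm⟩ := Nat.find_spec hex
  rw [← hm] at hnm hcm
  have hlt : ∀ t, n ≤ t → t < m → ∑ r ∈ Finset.Ico n t, γ r < c := fun t h1 h2 => by
    by_contra! h3
    exact Nat.find_min hex h2 ⟨h1, h3⟩
  have hbig : ∀ t ∈ Finset.Ico n m, ε / 2 ≤ u t := by
    intro t ht
    obtain ⟨h1, h2⟩ := Finset.mem_Ico.1 ht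
    have h3 := h n t h1
    have h4 := mul_le_mul_of_nonneg_left ((hlt t h1 h2).le) hK
    have h5 := hN₃ n hn3
    have h6 := hN₃ t (hn3.trans h1)
    nlinarith
  have hsum : c * (ε / 2) ^ 2 ≤ ∑ t ∈ Finset.Ico n m, γ t * u t ^ 2 := by
    calc c * (ε / 2) ^ 2 ≤ (∑ r ∈ Finset.Ico n m, γ r) * (ε / 2) ^ 2 := by gcongr
      _ = ∑ r ∈ Finset.Ico n m, γ r * (ε / 2) ^ 2 := Finset.sum_mul _ _ _
      _ ≤ _ := Finset.sum_le_sum fun t ht => by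
        have := hbig t ht
        have := hγ0 t
        gcongr
  have h7 := hN₁ m (hn1.trans hnm) n hn1
  rw [Real.dist_eq, ← Finset.sum_Ico_eq_sub _ hnm] at h7
  linarith [le_abs_self (∑ t ∈ Finset.Ico n m, γ t * u t ^ 2)]

/-! ### Gradients relative to a convex set and variational inequalities. -/

section Gradient

variable {H : Type*} [NormedAddCommGroup H] [InnerProductSpace ℝ H]

theorem hasDerivWithinAt_segment [CompleteSpace H] {h : H → ℝ} {g : H} {K : Set H}
    (hK : Convex ℝ K) {x y : H} (hx : x ∈ K) (hy : y ∈ K) {s : ℝ}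
    (hg : HasGradientWithinAt h g K (x + s • (y - x))) :
    HasDerivWithinAt (fun r : ℝ => h (x + r • (y - x))) (inner ℝ g (y - x)) (Icc 0 1) s := by
  have h1 : HasDerivWithinAt (fun r : ℝ => x + r • (y - x)) (y - x) (Icc 0 1) s := by
    simpa using ((hasDerivWithinAt_id s (Icc (0 : ℝ) 1)).smul_const (y - x)).const_add x
  have h2 : MapsTo (fun r : ℝ => x + r • (y - x)) (Icc 0 1) K := fun r hr =>
    hK.add_smul_sub_mem hx hy hr
  have h3 := (hasGradientWithinAt_iff_hasFDerivWithinAt.1 hg).comp_hasDerivWithinAt s h1 h2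
  rw [InnerProductSpace.toDual_apply_apply] at h3
  exact h3

theorem ConvexOn.add_inner_le_of_hasGradientWithinAt [CompleteSpace H] {h : H → ℝ} {g : H}
    {K : Set H} (hc : ConvexOn ℝ K h) {x y : H} (hx : x ∈ K) (hy : y ∈ K)
    (hg : HasGradientWithinAt h g K x) : h x + inner ℝ g (y - x) ≤ h y := by
  have h1 := hasDerivWithinAt_segment hc.1 hx hy (s := 0) (by simpa using hg)
  have h2 : ConvexOn ℝ (Icc (0 : ℝ) 1) (fun r : ℝ => h (x + r • (y - x))) := by
    have := hc.comp_affineMap (AffineMap.lineMap x y : ℝ →ᵃ[ℝ] H)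
    have h3 := this.subset (s := Icc (0 : ℝ) 1) (fun r hr => by
      simp only [mem_preimage, AffineMap.lineMap_apply, vsub_eq_sub, vadd_eq_add, add_comm]
      exact hc.1.add_smul_sub_mem hx hy hr) (convex_Icc _ _)
    refine h3.congr fun r _ => ?_
    simp [AffineMap.lineMap_apply, add_comm]
  have h4 := h2.le_slope_of_hasDerivWithinAt (by simp) (by simp) zero_lt_one h1
  simp only [slope_def_field, zero_smul, one_smul, add_zero, add_sub_cancel, sub_zero,
    div_one] at h4
  linarith

/-- The mean value theorem along the segment gives the constant `L` in place of the sharp `L / 2`;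
this is enough because the term is multiplied by `γ²` later. -/
theorem le_add_inner_add_of_lipschitzOnWith [CompleteSpace H] {h : H → ℝ} {g : H → H}
    {K : Set H} (hK : Convex ℝ K) {L : NNReal}
    (hg : ∀ x ∈ K, HasGradientWithinAt h (g x) K x) (hL : LipschitzOnWith L g K) {x y : H}
    (hx : x ∈ K) (hy : y ∈ K) :
    h y ≤ h x + inner ℝ (g x) (y - x) + L * ‖y - x‖ ^ 2 := by
  have hmem : ∀ s ∈ Icc (0 : ℝ) 1, x + s • (y - x) ∈ K := fun s hs =>
    hK.add_smul_sub_mem hx hy hs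
  have h1 : ∀ s ∈ Icc (0 : ℝ) 1, HasDerivWithinAt (fun r : ℝ => h (x + r • (y - x)))
      (inner ℝ (g (x + s • (y - x))) (y - x)) (Icc 0 1) s := fun s hs =>
    hasDerivWithinAt_segment hK hx hy (hg _ (hmem s hs))
  obtain ⟨c, hc, hc'⟩ := exists_hasDerivAt_eq_slope (fun r : ℝ => h (x + r • (y - x)))
    (fun s => inner ℝ (g (x + s • (y - x))) (y - x)) zero_lt_one
    (fun s hs => (h1 s hs).continuousWithinAt)
    (fun s hs => (h1 s (Ioo_subset_Icc_self hs)).hasDerivAt (Icc_mem_nhds hs.1 hs.2))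
  simp only [zero_smul, one_smul, add_zero, add_sub_cancel, sub_zero, div_one] at hc'
  have h2 : inner ℝ (g (x + c • (y - x)) - g x) (y - x) ≤ L * ‖y - x‖ ^ 2 := by
    refine (real_inner_le_norm _ _).trans ?_
    have h3 := hL.norm_sub_le (hmem c (Ioo_subset_Icc_self hc)) hx
    rw [add_sub_cancel_left, norm_smul, Real.norm_of_nonneg hc.1.le] at h3
    have h4 : c * ‖y - x‖ ≤ ‖y - x‖ := mul_le_of_le_one_left (norm_nonneg _) hc.2.le
    calc _ ≤ (L * (c * ‖y - x‖)) * ‖y - x‖ := by gcongr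
      _ ≤ (L * ‖y - x‖) * ‖y - x‖ := by gcongr
      _ = _ := by ring
  rw [inner_sub_left] at h2
  linarith

theorem inner_nonneg_of_isMinOn [CompleteSpace H] {h : H → ℝ} {g : H} {K : Set H}
    (hK : Convex ℝ K) {x y : H} (hx : x ∈ K) (hy : y ∈ K)
    (hg : HasGradientWithinAt h g K x) (hmin : IsMinOn h K x) : 0 ≤ inner ℝ g (y - x) := by
  have := hmin.localize.hasFDerivWithinAt_nonneg
    (hasGradientWithinAt_iff_hasFDerivWithinAt.1 hg)
    (sub_mem_posTangentConeAt_of_segment_subset (hK.segment_subset hx hy))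
  simpa using this

/-- Adding the two inequalities makes the proximal terms contribute `-2τ‖p - q‖²`, so strong
monotonicity turns a perturbation of the linear part into a bound on the solutions. -/
theorem norm_sub_le_of_variational_inequality {τ : ℝ} (hτ : 0 < τ) {g g' p q : H}
    (hp : 0 ≤ inner ℝ (g + (2 * τ) • p) (q - p))
    (hq : 0 ≤ inner ℝ (g' + (2 * τ) • q) (p - q)) :
    ‖p - q‖ ≤ (2 * τ)⁻¹ * ‖g - g'‖ := by
  have h1 : 2 * τ * ‖p - q‖ ^ 2 ≤ ‖g - g'‖ * ‖p - q‖ := by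
    have h2 : inner ℝ (g - g') (q - p) ≤ ‖g - g'‖ * ‖q - p‖ := real_inner_le_norm _ _
    rw [norm_sub_rev q p] at h2
    have h3 : inner ℝ (g + (2 * τ) • p) (q - p) + inner ℝ (g' + (2 * τ) • q) (p - q) =
        inner ℝ (g - g') (q - p) - 2 * τ * ‖p - q‖ ^ 2 := by
      rw [← real_inner_self_eq_norm_sq]
      simp only [inner_add_left, inner_sub_left, inner_sub_right, real_inner_smul_left,
        real_inner_comm p q]
      ring
    linarith
  rw [inv_mul_eq_div, le_div_iff₀ (by positivity)]
  rcases (norm_nonneg (p - q)).eq_or_lt with h0 | h0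
  · rw [← h0]; simp
  · nlinarith

end Gradient

/-! ### Almost sure decay of the averaged gradient noise. -/

section Noise

variable {Ω : Type*} {m0 : MeasurableSpace Ω} {P : Measure Ω}
  {H : Type*} [NormedAddCommGroup H] [InnerProductSpace ℝ H]

theorem ae_summable_of_sum_integral_le {g : ℕ → Ω → ℝ} {K : ℝ}
    (hg0 : ∀ t, 0 ≤ g t) (hg : ∀ t, Integrable (g t) P)
    (hK : ∀ n, ∑ t ∈ Finset.range n, ∫ ω, g t ω ∂P ≤ K) :
    ∀ᵐ ω ∂P, Summable fun t => g t ω := by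
  have hsum : Summable fun t => ∫ ω, g t ω ∂P :=
    summable_of_sum_range_le (fun t => integral_nonneg (hg0 t)) hK
  have h1 : ∫⁻ ω, ∑' t, ENNReal.ofReal (g t ω) ∂P ≠ ⊤ := by
    rw [lintegral_tsum fun t => (hg t).aestronglyMeasurable.aemeasurable.ennreal_ofReal]
    simp_rw [← fun t => ofReal_integral_eq_lintegral_ofReal (hg t) (ae_of_all _ (hg0 t))]
    exact hsum.tsum_ofReal_ne_top
  have h2 : AEMeasurable (fun ω => ∑' t, ENNReal.ofReal (g t ω)) P :=
    AEMeasurable.tsum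
      fun t => (hg t).aestronglyMeasurable.aemeasurable.ennreal_ofReal
  filter_upwards [ae_lt_top' h2 h1] with ω hω
  have h3 := ENNReal.summable_toReal hω.ne
  exact h3.congr fun t => by rw [ENNReal.toReal_ofReal (hg0 t ω)]

/-- The exponentially weighted sum of the increments `u` with forgetting factors `1 - ρ`. -/
def noiseAverage (ρ : ℕ → Ω → ℝ) (u : ℕ → Ω → H) : ℕ → Ω → H
  | 0 => 0
  | t + 1 => fun ω => (1 - ρ t ω) • noiseAverage ρ u t ω - u t ω

theorem stronglyMeasurable_noiseAverage {𝓕 : Filtration ℕ m0} {ρ : ℕ → Ω → ℝ} {u : ℕ → Ω → H}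
    (hρ : ∀ t, StronglyMeasurable[𝓕 t] (ρ t)) (hu : ∀ t, StronglyMeasurable[𝓕 (t + 1)] (u t))
    (t : ℕ) : StronglyMeasurable[𝓕 t] (noiseAverage ρ u t) := by
  induction t with
  | zero => exact stronglyMeasurable_zero
  | succ t ih =>
    have h1 := (hρ t).mono (𝓕.mono (Nat.le_succ t))
    exact (((stronglyMeasurable_const (b := (1 : ℝ))).sub h1).smul
      (ih.mono (𝓕.mono (Nat.le_succ t)))).sub (hu t)

theorem memLp_noiseAverage {ρ : ℕ → Ω → ℝ} {u : ℕ → Ω → H}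
    (hρ : ∀ t, StronglyMeasurable (ρ t)) (hρ01 : ∀ t ω, ρ t ω ∈ Icc (0 : ℝ) 1)
    (hu : ∀ t, MemLp (u t) 2 P) (t : ℕ) : MemLp (noiseAverage ρ u t) 2 P := by
  induction t with
  | zero => exact MemLp.zero
  | succ t ih =>
    refine MemLp.sub (MemLp.of_le_mul (c := 1) ih ?_ (ae_of_all _ fun ω => ?_)) (hu t)
    · exact ((stronglyMeasurable_const (b := (1 : ℝ))).sub (hρ t)).aestronglyMeasurable.smul ih.1
    · rw [norm_smul, Real.norm_of_nonneg (sub_nonneg.2 (hρ01 t ω).2)]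
      gcongr
      linarith [(hρ01 t ω).1]

theorem norm_noiseAverage_succ_sq (ρ : ℕ → Ω → ℝ) (u : ℕ → Ω → H) (t : ℕ) (ω : Ω) :
    ‖noiseAverage ρ u (t + 1) ω‖ ^ 2 = (1 - ρ t ω) ^ 2 * ‖noiseAverage ρ u t ω‖ ^ 2
      - 2 * inner ℝ ((1 - ρ t ω) • noiseAverage ρ u t ω) (u t ω) + ‖u t ω‖ ^ 2 := by
  rw [noiseAverage, norm_sub_sq_real, norm_smul, mul_pow, Real.norm_eq_abs, sq_abs]

/-- Expanding the square, `‖a‖²` gains `‖u‖²`, loses `c = (1 - (1 - ρ)²)‖a‖²`, and changes by a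
cross term with zero conditional mean. Taking expectations bounds `∑ c`, and martingale convergence
handles the cross terms. -/
theorem noiseAverage_convergence_of_integral_le [CompleteSpace H] [IsFiniteMeasure P]
    {𝓕 : Filtration ℕ m0}
    {ρ : ℕ → Ω → ℝ} {u : ℕ → Ω → H} {K : ℝ}
    (hρ : ∀ t, StronglyMeasurable[𝓕 t] (ρ t)) (hρ01 : ∀ t ω, ρ t ω ∈ Icc (0 : ℝ) 1)
    (hu : ∀ t, StronglyMeasurable[𝓕 (t + 1)] (u t)) (hu2 : ∀ t, MemLp (u t) 2 P)
    (hmean : ∀ t, P[u t | 𝓕 t] =ᵐ[P] 0)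
    (hK : ∀ n, ∑ t ∈ Finset.range n, ∫ ω, ‖u t ω‖ ^ 2 ∂P ≤ K) :
    ∀ᵐ ω ∂P, (Summable fun t => ρ t ω * ‖noiseAverage ρ u t ω‖ ^ 2) ∧
      ∃ ℓ, Tendsto (fun t => ‖noiseAverage ρ u t ω‖ ^ 2) atTop (𝓝 ℓ) := by
  set a := noiseAverage ρ u with ha
  have hρm : ∀ t, StronglyMeasurable (ρ t) := fun t => (hρ t).mono (𝓕.le t)
  have ham := stronglyMeasurable_noiseAverage hρ hu
  have ha2 : ∀ t, MemLp (a t) 2 P := memLp_noiseAverage hρm hρ01 hu2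
  have hb2 : ∀ t, MemLp (fun ω => (1 - ρ t ω) • a t ω) 2 P := fun t => by
    exact ((ha2 (t + 1)).add (hu2 t)).ae_eq (ae_of_all _ fun ω => by simp [ha, noiseAverage])
  have hbm : ∀ t, StronglyMeasurable[𝓕 t] (fun ω => (1 - ρ t ω) • a t ω) := fun t =>
    ((stronglyMeasurable_const (b := (1 : ℝ))).sub (hρ t)).smul (ham t)
  have hui : ∀ t, Integrable (fun ω => ‖u t ω‖ ^ 2) P := fun t =>
    (hu2 t).norm.integrable_sq
  have hai : ∀ t, Integrable (fun ω => ‖a t ω‖ ^ 2) P := fun t => (ha2 t).norm.integrable_sq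
  set c : ℕ → Ω → ℝ := fun t ω => (1 - (1 - ρ t ω) ^ 2) * ‖a t ω‖ ^ 2 with hc
  have hci : ∀ t, Integrable (c t) P := fun t => by
    have h1 := (hai t).sub (hb2 t).norm.integrable_sq
    refine h1.congr (ae_of_all _ fun ω => ?_)
    simp only [hc, Pi.sub_apply, norm_smul, mul_pow, Real.norm_eq_abs, sq_abs]
    ring
  have hc0 : ∀ t, 0 ≤ c t := fun t ω => by
    have := hρ01 t ω
    refine mul_nonneg ?_ (sq_nonneg _)
    nlinarith [this.1, this.2]
  -- The sum of the cross terms, solved for from the energy identity: a martingale of mean zero from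
  -- which `‖a n‖²` can be recovered.
  set Z : ℕ → Ω → ℝ := fun n ω => ∑ t ∈ Finset.range n, ‖u t ω‖ ^ 2 - ‖a n ω‖ ^ 2
    - ∑ t ∈ Finset.range n, c t ω with hZ
  have hZi : ∀ n, Integrable (Z n) P := fun n =>
    ((integrable_finsetSum _ fun t _ => hui t).sub (hai n)).sub
      (integrable_finsetSum _ fun t _ => hci t)
  have hZd : ∀ n, Z (n + 1) - Z n =
      fun ω => innerSL ℝ ((2 : ℝ) • (1 - ρ n ω) • a n ω) (u n ω) := fun n => by
    ext ω
    have := norm_noiseAverage_succ_sq ρ u n ω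
    simp only [hZ, hc, Pi.sub_apply, Finset.sum_range_succ, innerSL_apply_apply, ha] at this ⊢
    simp only [this, real_inner_smul_left]
    ring
  have hZint : ∀ n, Integrable
      (fun ω => innerSL ℝ ((2 : ℝ) • (1 - ρ n ω) • a n ω) (u n ω)) P := fun n => by
    rw [← hZd]; exact (hZi _).sub (hZi _)
  have hZc : ∀ n, P[Z (n + 1) - Z n | 𝓕 n] =ᵐ[P] 0 := fun n => by
    rw [hZd]
    have h1 := condExp_bilin_of_stronglyMeasurable_left (m := 𝓕 n) (innerSL ℝ)
      ((hbm n).const_smul (2 : ℝ)) (hZint n) ((hu2 n).integrable (by norm_num))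
    refine h1.trans ?_
    filter_upwards [hmean n] with ω hω
    rw [hω]; simp
  have hZadp : StronglyAdapted 𝓕 Z := fun n => by
    refine StronglyMeasurable.sub (StronglyMeasurable.sub ?_ ?_) ?_
    · refine Finset.stronglyMeasurable_fun_sum _ fun t ht => ?_
      exact (((hu t).mono (𝓕.mono (Finset.mem_range.1 ht))).norm).pow 2
    · exact (ham n).norm.pow 2
    · refine Finset.stronglyMeasurable_fun_sum _ fun t ht => ?_
      have hle := 𝓕.mono (Finset.mem_range.1 ht).le
      exact ((stronglyMeasurable_const (b := (1 : ℝ))).sub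
        (((stronglyMeasurable_const (b := (1 : ℝ))).sub ((hρ t).mono hle)).pow 2)).mul
        (((ham t).mono hle).norm.pow 2)
  have hsub : Submartingale Z 𝓕 P :=
    submartingale_of_condExp_sub_nonneg_nat hZadp hZi fun n => (hZc n).symm.le
  have hZ0 : ∀ n, ∫ ω, Z n ω ∂P = 0 := by
    intro n
    induction n with
    | zero => simp [hZ, ha, noiseAverage]
    | succ n ih =>
      have h1 : ∫ ω, (Z (n + 1) - Z n) ω ∂P = 0 := by
        rw [← integral_condExp (𝓕.le n), integral_congr_ae (hZc n)]; simp
      have h2 : ∫ ω, (Z (n + 1) - Z n) ω ∂P = ∫ ω, Z (n + 1) ω ∂P - ∫ ω, Z n ω ∂P :=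
        integral_sub (hZi _) (hZi _)
      linarith
  have hbal : ∀ n, ∫ ω, ‖a n ω‖ ^ 2 ∂P + ∑ t ∈ Finset.range n, ∫ ω, c t ω ∂P =
      ∑ t ∈ Finset.range n, ∫ ω, ‖u t ω‖ ^ 2 ∂P := fun n => by
    have h1 := hZ0 n
    have hI : Integrable (fun ω => ∑ t ∈ Finset.range n, ‖u t ω‖ ^ 2 - ‖a n ω‖ ^ 2) P :=
      (integrable_finsetSum _ fun t _ => hui t).sub (hai n)
    simp only [hZ] at h1
    rw [integral_sub hI (integrable_finsetSum _ fun t _ => hci t),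
      integral_sub (integrable_finsetSum _ fun t _ => hui t) (hai n),
      integral_finsetSum _ fun t _ => hui t, integral_finsetSum _ fun t _ => hci t] at h1
    linarith
  have hcK : ∀ n, ∑ t ∈ Finset.range n, ∫ ω, c t ω ∂P ≤ K := fun n => by
    have h1 := hbal n
    have h2 : 0 ≤ ∫ ω, ‖a n ω‖ ^ 2 ∂P := integral_nonneg fun ω => sq_nonneg _
    linarith [hK n]
  -- The energy balance gives `E‖a n‖² + ∑ E c = ∑ E‖u‖² ≤ K`, hence `E|Z n| ≤ 2K`.
  have hL1 : ∀ n, eLpNorm (Z n) 1 P ≤ (Real.toNNReal (2 * K) : NNReal) := fun n => by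
    rw [eLpNorm_one_eq_lintegral_enorm, ← ofReal_integral_norm_eq_lintegral_enorm (hZi n)]
    refine ENNReal.ofReal_le_ofReal ?_
    have hI := integrable_finsetSum (μ := P) (Finset.range n) fun t _ => hui t
    have hI' := integrable_finsetSum (μ := P) (Finset.range n) fun t _ => hci t
    have h1 : ∫ ω, ‖Z n ω‖ ∂P ≤ ∫ ω, (∑ t ∈ Finset.range n, ‖u t ω‖ ^ 2 + ‖a n ω‖ ^ 2
        + ∑ t ∈ Finset.range n, c t ω) ∂P := by
      refine integral_mono (hZi n).norm ((hI.add (hai n)).add hI') fun ω => ?_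
      have h2 : 0 ≤ ∑ t ∈ Finset.range n, ‖u t ω‖ ^ 2 := Finset.sum_nonneg fun t _ => sq_nonneg _
      have h3 : 0 ≤ ∑ t ∈ Finset.range n, c t ω := Finset.sum_nonneg fun t _ => hc0 t ω
      have h4 := sq_nonneg ‖a n ω‖
      simp only [Real.norm_eq_abs, hZ]
      rw [abs_le]
      constructor <;> linarith
    refine h1.trans ?_
    have hIa : Integrable (fun ω => ∑ t ∈ Finset.range n, ‖u t ω‖ ^ 2 + ‖a n ω‖ ^ 2) P :=
      hI.add (hai n)
    rw [integral_add hIa hI', integral_add hI (hai n),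
      integral_finsetSum _ fun t _ => hui t, integral_finsetSum _ fun t _ => hci t]
    linarith [hbal n, hK n]
  filter_upwards [hsub.exists_ae_tendsto_of_bdd hL1,
    ae_summable_of_sum_integral_le (fun t ω => sq_nonneg ‖u t ω‖) hui hK,
    ae_summable_of_sum_integral_le hc0 hci hcK] with ω ⟨z, hz⟩ hω1 hω2
  constructor
  · refine hω2.of_nonneg_of_le (fun t => mul_nonneg (hρ01 t ω).1 (sq_nonneg _)) fun t => ?_
    refine mul_le_mul_of_nonneg_right ?_ (sq_nonneg _)
    -- `ρ ≤ 1 - (1 - ρ)²` on `[0, 1]`.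
    nlinarith [(hρ01 t ω).1, (hρ01 t ω).2]
  · refine ⟨_, ((hω1.hasSum.tendsto_sum_nat.sub hω2.hasSum.tendsto_sum_nat).sub hz).congr
      fun n => ?_⟩
    simp only [hZ]
    ring

/-- The variance bound is random, so the total energy `∑ ρ² v` is finite almost surely but need not
be integrable. Localization repairs this: the increments are switched off once the accumulated
conditional energy exceeds `K`, and almost every path is untouched for some integer `K`. -/
theorem noiseAverage_convergence [CompleteSpace H] [IsFiniteMeasure P]
    {𝓕 : Filtration ℕ m0} {ρ : ℕ → Ω → ℝ} {e : ℕ → Ω → H}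
    (hρ : ∀ t, StronglyMeasurable[𝓕 t] (ρ t)) (hρ01 : ∀ t ω, ρ t ω ∈ Icc (0 : ℝ) 1)
    (he : ∀ t, StronglyMeasurable[𝓕 (t + 1)] (e t)) (he2 : ∀ t, MemLp (e t) 2 P)
    (hmean : ∀ t, P[e t | 𝓕 t] =ᵐ[P] 0)
    (hvar : ∀ᵐ ω ∂P, ∃ B : ℝ, ∀ t, (P[fun ω' => ‖e t ω'‖ ^ 2 | 𝓕 t]) ω ≤ B)
    (hρs : ∀ᵐ ω ∂P, Tendsto (fun n => ∑ t ∈ Finset.range n, ρ t ω) atTop atTop ∧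
      Summable (fun t => ρ t ω ^ 2)) :
    ∀ᵐ ω ∂P, (Summable fun t => ρ t ω *
        ‖noiseAverage ρ (fun t ω => ρ t ω • e t ω) t ω‖ ^ 2) ∧
      Tendsto (fun t => noiseAverage ρ (fun t ω => ρ t ω • e t ω) t ω) atTop (𝓝 0) := by
  set v : ℕ → Ω → ℝ := fun t => P[fun ω' => ‖e t ω'‖ ^ 2 | 𝓕 t] with hv
  have hvm : ∀ t, StronglyMeasurable[𝓕 t] (v t) := fun t => stronglyMeasurable_condExp
  have hv0 : ∀ᵐ ω ∂P, ∀ t, 0 ≤ v t ω :=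
    ae_all_iff.2 fun t => condExp_nonneg (ae_of_all _ fun ω => sq_nonneg _)
  -- The sum includes the term `s = t` and is still `𝓕 t`-measurable, since both `ρ t` and `v t`
  -- are; the truncation below is therefore predictable.
  set A : ℕ → Ω → ℝ := fun t ω => ∑ s ∈ Finset.range (t + 1), ρ s ω ^ 2 * v s ω with hA
  have hAm : ∀ t, StronglyMeasurable[𝓕 t] (A t) := fun t =>
    Finset.stronglyMeasurable_fun_sum _ fun s hs => by
      have hle := 𝓕.mono (Nat.lt_succ_iff.1 (Finset.mem_range.1 hs))
      exact (((hρ s).mono hle).pow 2).mul ((hvm s).mono hle)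
  have hei : ∀ t, Integrable (fun ω => ‖e t ω‖ ^ 2) P := fun t => (he2 t).norm.integrable_sq
  have key : ∀ K : ℕ, ∀ᵐ ω ∂P, (∀ t, A t ω ≤ K) →
      (Summable fun t => ρ t ω * ‖noiseAverage ρ (fun t ω => ρ t ω • e t ω) t ω‖ ^ 2) ∧
      ∃ ℓ, Tendsto (fun t => ‖noiseAverage ρ (fun t ω => ρ t ω • e t ω) t ω‖ ^ 2) atTop
        (𝓝 ℓ) := by
    intro K
    set c : ℕ → Ω → ℝ := fun t => {ω | A t ω ≤ K}.indicator (ρ t) with hc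
    have hcm : ∀ t, StronglyMeasurable[𝓕 t] (c t) := fun t =>
      (hρ t).indicator ((hAm t).measurable measurableSet_Iic)
    have hc01 : ∀ t ω, c t ω ∈ Icc (0 : ℝ) 1 := fun t ω => by
      by_cases h : A t ω ≤ K
      · simpa [hc, indicator_of_mem (show ω ∈ {ω | A t ω ≤ K} from h)] using hρ01 t ω
      · simp [hc, indicator_of_notMem (show ω ∉ {ω | A t ω ≤ K} from h)]
    set u : ℕ → Ω → H := fun t ω => c t ω • e t ω with hu
    have hum : ∀ t, StronglyMeasurable[𝓕 (t + 1)] (u t) := fun t =>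
      ((hcm t).mono (𝓕.mono t.le_succ)).smul (he t)
    have hu2 : ∀ t, MemLp (u t) 2 P := fun t => by
      refine MemLp.of_le_mul (c := 1) (he2 t)
        ((hum t).mono (𝓕.le _)).aestronglyMeasurable (ae_of_all _ fun ω => ?_)
      rw [hu, norm_smul, Real.norm_of_nonneg (hc01 t ω).1]
      exact mul_le_mul_of_nonneg_right (hc01 t ω).2 (norm_nonneg _)
    have humean : ∀ t, P[u t | 𝓕 t] =ᵐ[P] 0 := fun t => by
      have h1 := condExp_bilin_of_stronglyMeasurable_left (m := 𝓕 t)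
        (ContinuousLinearMap.lsmul ℝ ℝ) (hcm t) (g := e t)
        (by simpa [hu] using (hu2 t).integrable (by norm_num))
        ((he2 t).integrable (by norm_num))
      refine EventuallyEq.trans (by simp only [ContinuousLinearMap.lsmul_apply] at h1; exact h1) ?_
      filter_upwards [hmean t] with ω hω
      rw [hω]; simp
    have hint : ∀ t, Integrable (fun ω => c t ω ^ 2 * ‖e t ω‖ ^ 2) P := fun t =>
      (hu2 t).norm.integrable_sq.congr (ae_of_all _ fun ω => by
        simp [hu, norm_smul, mul_pow])
    have hpull : ∀ t, P[fun ω => c t ω ^ 2 * ‖e t ω‖ ^ 2 | 𝓕 t] =ᵐ[P]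
        fun ω => c t ω ^ 2 * v t ω := fun t =>
      condExp_mul_of_stronglyMeasurable_left (f := fun ω => c t ω ^ 2)
        (g := fun ω => ‖e t ω‖ ^ 2) ((hcm t).pow 2) (hint t) (hei t)
    have hvint : ∀ t, Integrable (fun ω => c t ω ^ 2 * v t ω) P := fun t =>
      integrable_condExp.congr (hpull t)
    -- At each `n` either `A n ≤ K`, which bounds the whole partial sum, or the last term has been
    -- switched off.
    have hpath : ∀ᵐ ω ∂P, ∀ n, ∑ t ∈ Finset.range n, c t ω ^ 2 * v t ω ≤ K := by
      filter_upwards [hv0] with ω hω n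
      induction n with
      | zero => simp
      | succ n ih =>
        by_cases h : A n ω ≤ K
        · refine le_trans (Finset.sum_le_sum fun t _ => ?_) h
          refine mul_le_mul_of_nonneg_right ?_ (hω t)
          have h1 : c t ω ≤ ρ t ω := indicator_le_self' (fun _ _ => (hρ01 t ω).1) ω
          exact pow_le_pow_left₀ (hc01 t ω).1 h1 2
        · rw [Finset.sum_range_succ]
          simpa [hc, indicator_of_notMem (show ω ∉ {ω | A n ω ≤ K} from h)] using ih
    have hK : ∀ n, ∑ t ∈ Finset.range n, ∫ ω, ‖u t ω‖ ^ 2 ∂P ≤ K * P.real univ := by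
      intro n
      have h1 : ∀ t, ∫ ω, ‖u t ω‖ ^ 2 ∂P = ∫ ω, c t ω ^ 2 * v t ω ∂P := fun t => by
        rw [← integral_congr_ae (hpull t), integral_condExp (𝓕.le t)]
        simp [hu, norm_smul, mul_pow]
      simp_rw [h1]
      rw [← integral_finsetSum _ fun t _ => hvint t]
      refine (integral_mono_ae (integrable_finsetSum _ fun t _ => hvint t)
        (integrable_const (K : ℝ)) ?_).trans (by simp [mul_comm])
      filter_upwards [hpath] with ω hω using hω n
    filter_upwards [noiseAverage_convergence_of_integral_le hρ hρ01 hum hu2 humean hK] with ω hω hAK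
    -- Only the increments are truncated, not the forgetting factors, so on `A ≤ K` both averages
    -- obey the same recursion.
    have heq : ∀ t, noiseAverage ρ u t ω = noiseAverage ρ (fun t ω => ρ t ω • e t ω) t ω := by
      intro t
      induction t with
      | zero => rfl
      | succ t ih =>
        have hct : c t ω = ρ t ω := indicator_of_mem (show ω ∈ {ω | A t ω ≤ K} from hAK t) _
        change (1 - ρ t ω) • noiseAverage ρ u t ω - c t ω • e t ω = _
        rw [ih, hct]
        rfl
    simpa only [heq] using hω
  filter_upwards [ae_all_iff.2 key, hvar, hv0, hρs] with ω hkey ⟨B, hB⟩ hω0 ⟨hdiv, hsum⟩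
  obtain ⟨K, hK⟩ := exists_nat_ge (|B| * ∑' t, ρ t ω ^ 2)
  have hAK : ∀ t, A t ω ≤ K := fun t => by
    refine le_trans ?_ hK
    calc A t ω ≤ ∑ s ∈ Finset.range (t + 1), |B| * ρ s ω ^ 2 :=
          Finset.sum_le_sum fun s _ => by
            rw [mul_comm]
            exact mul_le_mul_of_nonneg_right ((hB s).trans (le_abs_self B)) (sq_nonneg _)
      _ = |B| * ∑ s ∈ Finset.range (t + 1), ρ s ω ^ 2 := (Finset.mul_sum _ _ _).symm
      _ ≤ _ := mul_le_mul_of_nonneg_left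
        (hsum.sum_le_tsum _ fun s _ => sq_nonneg _) (abs_nonneg _)
  obtain ⟨h1, ℓ, hℓ⟩ := hkey K hAK
  refine ⟨h1, ?_⟩
  have h2 := eq_zero_of_summable_mul_of_tendsto (fun t => (hρ01 t ω).1)
    (fun t => sq_nonneg _) hdiv h1 hℓ
  rw [h2] at hℓ
  rw [tendsto_zero_iff_norm_tendsto_zero]
  have h3 := (Real.continuous_sqrt.tendsto 0).comp hℓ
  simpa [Function.comp_def, Real.sqrt_sq] using h3

end Noise

/-! ### Block structure and optimality of a single best response. -/

namespace StochSCA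

variable {N M : ℕ} {E : Fin N → Type*} {Ξ : Type*} {X : ∀ i, Set (E i)}

theorem withBlock_self (x : Joint E) (i : Fin N) : withBlock x i (x i) = x := by
  simp [withBlock]

theorem withBlock_mem {x : Joint E} (hx : x ∈ feasible X) {i : Fin N} {z : E i} (hz : z ∈ X i) :
    withBlock x i z ∈ feasible X := by
  intro k
  by_cases h : k = i
  · subst h; simpa [withBlock] using hz
  · simpa [withBlock, h] using hx k

variable [∀ i, NormedAddCommGroup (E i)]

theorem isCompact_feasible (hX : ∀ i, IsCompact (X i)) : IsCompact (feasible X) := by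
  have h := (isCompact_univ_pi hX).image
    (PiLp.continuous_toLp 2 E)
  convert h using 1
  ext x
  constructor
  · exact fun hx => ⟨fun i => x i, fun i _ => hx i, rfl⟩
  · rintro ⟨y, hy, rfl⟩ i
    exact hy i (mem_univ i)

theorem withBlock_sub_withBlock (x : Joint E) (i : Fin N) (z z' : E i) :
    withBlock x i z' - withBlock x i z = PiLp.single 2 i (z' - z) := by
  ext k
  by_cases h : k = i
  · subst h; simp [withBlock]
  · simp [withBlock, h]

theorem norm_withBlock_sub_withBlock (x : Joint E) (i : Fin N) (z z' : E i) :
    ‖withBlock x i z' - withBlock x i z‖ = ‖z' - z‖ := by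
  rw [withBlock_sub_withBlock, PiLp.norm_single]

theorem norm_sum_gradf_withBlock_sub_le {gradf : Fin M → Joint E → Ξ → Joint E}
    {L : Fin M → Ξ → NNReal} {C : Finset (Fin M)} {x : Joint E} {s : Ξ} {i : Fin N} {z : E i}
    (hL : ∀ j, LipschitzOnWith (L j s) (fun x => gradf j x s) (feasible X))
    (hx : x ∈ feasible X) (hz : z ∈ X i) :
    ‖∑ j ∈ C, (gradf j (withBlock x i z) s i - gradf j x s i)‖ ≤
      (∑ j, (L j s : ℝ)) * ‖z - x i‖ := by
  refine (norm_sum_le _ _).trans ?_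
  rw [Finset.sum_mul]
  refine (Finset.sum_le_sum fun j _ => ?_).trans (Finset.sum_le_univ_sum_of_nonneg fun j =>
    mul_nonneg (NNReal.coe_nonneg _) (norm_nonneg _))
  have h1 := (hL j).norm_sub_le (withBlock_mem hx hz) hx
  have h2 := norm_withBlock_sub_withBlock x i (x i) z
  rw [withBlock_self] at h2
  rw [h2] at h1
  exact (PiLp.norm_apply_le (gradf j (withBlock x i z) s - gradf j x s) i).trans h1

variable [∀ i, InnerProductSpace ℝ (E i)]

theorem convex_feasible (hX : ∀ i, Convex ℝ (X i)) : Convex ℝ (feasible X) :=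
  fun _ hx _ hy _ _ ha hb hab i => hX i (hx i) (hy i) ha hb hab

theorem inner_single_right (g : Joint E) (i : Fin N) (v : E i) :
    inner ℝ g (PiLp.single 2 i v : Joint E) = inner ℝ (g i) v := by
  rw [PiLp.inner_apply, Finset.sum_eq_single i]
  · simp
  · intro k _ hk; simp [hk]
  · simp

variable [∀ i, CompleteSpace (E i)]

theorem hasGradientWithinAt_withBlock {h : Joint E → ℝ} {g : Joint E} {x : Joint E}
    (hx : x ∈ feasible X) {i : Fin N} {z : E i}
    (hg : HasGradientWithinAt h g (feasible X) (withBlock x i z)) :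
    HasGradientWithinAt (fun z => h (withBlock x i z)) (g i) (X i) z := by
  rw [hasGradientWithinAt_iff_isLittleO] at hg ⊢
  have h1 : Tendsto (withBlock x i) (𝓝[X i] z) (𝓝[feasible X] (withBlock x i z)) := by
    refine tendsto_nhdsWithin_iff.2 ⟨?_, eventually_mem_nhdsWithin.mono fun z' hz' =>
      withBlock_mem hx hz'⟩
    rw [tendsto_iff_norm_sub_tendsto_zero]
    simp_rw [norm_withBlock_sub_withBlock]
    exact tendsto_iff_norm_sub_tendsto_zero.1 (tendsto_nhds_of_tendsto_nhdsWithin tendsto_id)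
  have h2 := hg.comp_tendsto h1
  refine Asymptotics.IsLittleO.of_norm_right ?_
  refine (h2.norm_right.congr_left fun z' => ?_).congr_right fun z' => ?_
  · simp only [Function.comp_apply, withBlock_sub_withBlock, inner_single_right]
  · simp only [Function.comp_apply, norm_withBlock_sub_withBlock]

section Step

variable {f : Fin M → Joint E → Ξ → ℝ} {gradf : Fin M → Joint E → Ξ → Joint E}
  {C : Finset (Fin M)} {x : Joint E} {s : Ξ} {i : Fin N} {z : E i}
  {r τ : ℝ} {a : E i}

/-- Compare the surrogate at its minimizer and at `x i`, bounding the kept convex functions below by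
their linearizations at `x`. The linear terms then combine exactly into the updated accumulation
vector. -/
theorem inner_accumulated_le_of_isMinOn
    (hf : ∀ j, HasGradientWithinAt (fun y => f j y s) (gradf j x s) (feasible X) x)
    (hx : x ∈ feasible X) (hr : 0 ≤ r)
    (hC : ∀ j ∈ C, ConvexOn ℝ (X i) (fun z => f j (withBlock x i z) s)) (hz : z ∈ X i)
    (hmin : IsMinOn (approx f gradf C τ r x s i a) (X i) z) :
    inner ℝ ((1 - r) • a + r • (pricing gradf C x s i + ∑ j ∈ C, gradf j x s i)) (z - x i)
      + τ * ‖z - x i‖ ^ 2 ≤ 0 := by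
  have h1 := hmin (hx i)
  simp only [mem_ofPred_eq, approx, withBlock_self, sub_self, inner_zero_left, norm_zero] at h1
  have h2 : ∑ j ∈ C, f j x s + inner ℝ (∑ j ∈ C, gradf j x s i) (z - x i) ≤
      ∑ j ∈ C, f j (withBlock x i z) s := by
    rw [sum_inner, ← Finset.sum_add_distrib]
    refine Finset.sum_le_sum fun j hj => ?_
    have h3 := (hC j hj).add_inner_le_of_hasGradientWithinAt (hx i) hz (g := gradf j x s i)
      (hasGradientWithinAt_withBlock hx (i := i) (z := x i) (by rw [withBlock_self]; exact hf j))
    simpa [withBlock_self] using h3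
  have h4 := mul_le_mul_of_nonneg_left h2 hr
  simp only [inner_add_left, real_inner_smul_left]
  rw [real_inner_comm (pricing gradf C x s i), real_inner_comm a] at h1
  linarith

/-- The surrogate's gradient at `z` is regrouped around the updated accumulation vector. What is
left over is the change of the kept gradients between `x` and `z`, with a factor `r` that makes it
negligible. -/
theorem inner_nonneg_of_isMinOn_approx (hX : Convex ℝ (X i))
    (hf : ∀ j, ∀ y ∈ feasible X, HasGradientWithinAt (fun y => f j y s) (gradf j y s) (feasible X) y)
    (hx : x ∈ feasible X) (hz : z ∈ X i)
    (hmin : IsMinOn (approx f gradf C τ r x s i a) (X i) z) {y : E i} (hy : y ∈ X i) :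
    0 ≤ inner ℝ ((1 - r) • a + r • (pricing gradf C x s i + ∑ j ∈ C, gradf j x s i)
      + r • ∑ j ∈ C, (gradf j (withBlock x i z) s i - gradf j x s i)
      + (2 * τ) • (z - x i)) (y - z) := by
  refine inner_nonneg_of_isMinOn hX hz hy ?_ hmin
  rw [hasGradientWithinAt_iff_hasFDerivWithinAt]
  have h1 : HasFDerivWithinAt (fun z => ∑ j ∈ C, f j (withBlock x i z) s)
      (∑ j ∈ C, InnerProductSpace.toDual ℝ (E i) (gradf j (withBlock x i z) s i)) (X i) z :=
    HasFDerivWithinAt.fun_sum fun j _ => (hasGradientWithinAt_iff_hasFDerivWithinAt.1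
      (hasGradientWithinAt_withBlock hx (hf j _ (withBlock_mem hx hz))))
  have h2 : HasFDerivWithinAt (fun z : E i => z - x i) (ContinuousLinearMap.id ℝ (E i)) (X i) z :=
    (hasFDerivWithinAt_id z (X i)).sub_const (x i)
  have h3 : ∀ b : E i, HasFDerivWithinAt (fun z : E i => inner ℝ (z - x i) b)
      (InnerProductSpace.toDual ℝ (E i) b) (X i) z := fun b => by
    have h4 := ((InnerProductSpace.toDual ℝ (E i) b).hasFDerivAt.comp_hasFDerivWithinAt z h2)
    rw [ContinuousLinearMap.comp_id] at h4
    exact h4.congr (fun w _ => by simp [real_inner_comm]) (by simp [real_inner_comm])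
  have h5 := h2.norm_sq
  refine ((((h1.const_mul r).add ((h3 (pricing gradf C x s i)).const_mul r)).add
    ((h3 a).const_mul (1 - r))).add (h5.const_mul τ)).congr_fderiv ?_
  ext v
  simp only [add_apply, smul_apply,
    sum_apply, InnerProductSpace.toDual_apply_apply,
    inner_add_left, real_inner_smul_left, sum_inner, inner_sub_left, Finset.sum_sub_distrib,
    smul_eq_mul, ContinuousLinearMap.comp_apply, innerSL_apply_apply,
    ContinuousLinearMap.id_apply, nsmul_eq_mul, Nat.cast_ofNat]
  ring

end Step

end StochSCA

/-! ### Drift of the tracking error and the Lyapunov function. -/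

section Lyapunov

variable {H : Type*} [NormedAddCommGroup H] [InnerProductSpace ℝ H]

/-- Each step perturbs `b` by at most `L R γ = ρ · (L R γ / ρ)`, so the contraction lemma applies
with `ε = L R γ / ρ`. -/
theorem tendsto_zero_of_tracking {K : Set H} {g : H → H} {L : NNReal}
    (hL : LipschitzOnWith L g K) {x Δ b : ℕ → H} {γ ρ : ℕ → ℝ} {R : ℝ} (hx : ∀ t, x t ∈ K)
    (hstep : ∀ t, x (t + 1) - x t = γ t • Δ t) (hR : ∀ t, ‖Δ t‖ ≤ R)
    (hγ0 : ∀ t, 0 ≤ γ t) (hρ : ∀ t, ρ t ∈ Ioc (0 : ℝ) 1)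
    (hρs : Tendsto (fun n => ∑ t ∈ Finset.range n, ρ t) atTop atTop)
    (hγρ : Tendsto (fun t => γ t / ρ t) atTop (𝓝 0))
    (hb : ∀ t, b (t + 1) = (1 - ρ t) • (b t + (g (x t) - g (x (t + 1))))) :
    Tendsto b atTop (𝓝 0) := by
  rw [tendsto_zero_iff_norm_tendsto_zero]
  refine tendsto_zero_of_le_contraction (ε := fun t => L * R * (γ t / ρ t))
    (fun t => norm_nonneg _) (fun t => (hρ t).1.le) (fun t => (hρ t).2) hρs
    (by simpa using hγρ.const_mul (L * R)) fun t => ?_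
  have h1 : 0 ≤ 1 - ρ t := sub_nonneg.2 (hρ t).2
  have h2 : ‖g (x t) - g (x (t + 1))‖ ≤ L * R * γ t := by
    refine (hL.norm_sub_le (hx t) (hx (t + 1))).trans ?_
    rw [norm_sub_rev, hstep, norm_smul, Real.norm_of_nonneg (hγ0 t), mul_assoc, mul_comm R]
    gcongr
    · exact hγ0 t
    · exact hR t
  have hR0 : 0 ≤ R := (norm_nonneg _).trans (hR 0)
  rw [hb, norm_smul, Real.norm_of_nonneg h1]
  have h3 : ρ t * (L * R * (γ t / ρ t)) = L * R * γ t := by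
    field_simp [(hρ t).1.ne']
  rw [h3]
  calc (1 - ρ t) * ‖b t + (g (x t) - g (x (t + 1)))‖ ≤ (1 - ρ t) * (‖b t‖ + L * R * γ t) := by
        gcongr
        exact (norm_add_le _ _).trans (by gcongr)
    _ ≤ _ := by
        have : 0 ≤ ρ t * (L * R * γ t) := mul_nonneg (hρ t).1.le
          (mul_nonneg (mul_nonneg L.2 hR0) (hγ0 t))
        linarith

/-- Convexity of the square with weights `1 - r` and `r`, applied to `p` and `q / r`. -/
theorem sq_one_sub_mul_add_le {r p q : ℝ} (hr : r ∈ Ioc (0 : ℝ) 1) (hp : 0 ≤ p) (hq : 0 ≤ q) :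
    ((1 - r) * (p + q)) ^ 2 ≤ (1 - r) * p ^ 2 + q ^ 2 / r := by
  obtain ⟨h0, h1⟩ := hr
  have h2 : (1 - r) * (p + q) ≤ (1 - r) * p + q := by nlinarith
  have h3 : 0 ≤ (1 - r) * (p + q) := mul_nonneg (sub_nonneg.2 h1) (add_nonneg hp hq)
  refine (pow_le_pow_left₀ h3 h2 2).trans ?_
  have h4 : (1 - r) * p ^ 2 + q ^ 2 / r - ((1 - r) * p + q) ^ 2 =
      (1 - r) * (r * p - q) ^ 2 / r := by
    field_simp; ring
  have h5 : 0 ≤ (1 - r) * (r * p - q) ^ 2 / r :=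
    div_nonneg (mul_nonneg (sub_nonneg.2 h1) (sq_nonneg _)) h0.le
  linarith

/-- The drift error enters the descent of `U` as at most `ρ‖b‖²`, exactly what `‖b‖²` loses per
step; in `U + ‖b‖²` the two cancel. The noise contributes the summable `ρ‖n‖²`. -/
theorem summable_mul_norm_sq_of_descent [CompleteSpace H] {K : Set H} (hK : Convex ℝ K)
    {U : H → ℝ} {g : H → H} {L : NNReal} {m : ℝ}
    (hg : ∀ x ∈ K, HasGradientWithinAt U (g x) K x) (hL : LipschitzOnWith L g K)
    (hm : ∀ x ∈ K, m ≤ U x) {x Δ a n b : ℕ → H} {γ ρ : ℕ → ℝ} {c : ℝ} (hc : 0 < c)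
    (hx : ∀ t, x t ∈ K) (hstep : ∀ t, x (t + 1) - x t = γ t • Δ t)
    (hγ0 : ∀ t, 0 ≤ γ t) (hρ : ∀ t, ρ t ∈ Ioc (0 : ℝ) 1)
    (hγ : Tendsto γ atTop (𝓝 0)) (hγρ : Tendsto (fun t => γ t / ρ t) atTop (𝓝 0))
    (ha : ∀ t, a t = g (x t) + n t + b t)
    (hb : ∀ t, b (t + 1) = (1 - ρ t) • (b t + (g (x t) - g (x (t + 1)))))
    (hn : Summable fun t => ρ t * ‖n t‖ ^ 2)
    (hdesc : ∀ t, inner ℝ (a t) (Δ t) + c * ‖Δ t‖ ^ 2 ≤ 0) :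
    Summable fun t => γ t * ‖Δ t‖ ^ 2 := by
  -- The descent `c / 2` pays `c / 8` for the curvature of `U` and `c / 8` for the growth of `‖b‖²`,
  -- which leaves `c / 4`.
  have key : Summable fun t => c / 4 * (γ t * ‖Δ t‖ ^ 2) := by
    refine summable_of_eventually_descent (Φ := fun t => U (x t) + ‖b t‖ ^ 2) (m := m)
      (fun t => mul_nonneg (by positivity) (mul_nonneg (hγ0 t) (sq_nonneg _)))
      (fun t => mul_nonneg (hρ t).1.le (sq_nonneg _)) hn
      (fun t => by have := hm _ (hx t); have := sq_nonneg ‖b t‖; linarith) ?_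
    have e1 : ∀ᶠ t in atTop, L * γ t ≤ c / 8 :=
      (show Tendsto (fun t => L * γ t) atTop (𝓝 0) by
        simpa using hγ.const_mul (L : ℝ)).eventually_le_const (by positivity)
    have e2 : ∀ᶠ t in atTop, (L : ℝ) ^ 2 * (γ t / ρ t) ≤ c / 8 :=
      (show Tendsto (fun t => (L : ℝ) ^ 2 * (γ t / ρ t)) atTop (𝓝 0) by
        simpa using hγρ.const_mul ((L : ℝ) ^ 2)).eventually_le_const (by positivity)
    filter_upwards [e1, e2, hγρ.eventually_le_const hc] with t ht1 ht2 ht3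
    have hγt := hγ0 t
    have hρt := (hρ t).1
    have hγc : γ t ≤ c * ρ t := by rwa [div_le_iff₀ hρt] at ht3
    have h1 : U (x (t + 1)) ≤ U (x t) + γ t * inner ℝ (g (x t)) (Δ t)
        + L * (γ t * ‖Δ t‖) ^ 2 := by
      have := le_add_inner_add_of_lipschitzOnWith hK hg hL (hx t) (hx (t + 1))
      rwa [hstep, real_inner_smul_right, norm_smul, Real.norm_of_nonneg hγt] at this
    -- Young's inequality, multiplied through by `c` to avoid dividing.
    have h2 : c * inner ℝ (g (x t)) (Δ t) ≤
        -(c ^ 2 / 2) * ‖Δ t‖ ^ 2 + (‖n t‖ ^ 2 + ‖b t‖ ^ 2) := by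
      have h3 := hdesc t
      rw [ha, add_assoc, inner_add_left] at h3
      have h4 := (abs_le.1 (abs_real_inner_le_norm (n t + b t) (Δ t))).1
      have h5 := norm_add_le (n t) (b t)
      have h6 : ‖n t + b t‖ * ‖Δ t‖ ≤ (‖n t‖ + ‖b t‖) * ‖Δ t‖ := by gcongr
      have h7 : c * inner ℝ (g (x t)) (Δ t) ≤
          c * ((‖n t‖ + ‖b t‖) * ‖Δ t‖ - c * ‖Δ t‖ ^ 2) := by
        gcongr; linarith
      nlinarith [sq_nonneg (c * ‖Δ t‖ - (‖n t‖ + ‖b t‖)), sq_nonneg (‖n t‖ - ‖b t‖)]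
    -- Here `γ ≤ c ρ` trades the weight `γ / c` on the errors for `ρ`.
    have h8 : γ t * inner ℝ (g (x t)) (Δ t) ≤
        -(c / 2) * (γ t * ‖Δ t‖ ^ 2) + ρ t * (‖n t‖ ^ 2 + ‖b t‖ ^ 2) := by
      have h9 := mul_le_mul_of_nonneg_left h2 hγt
      have h10 : γ t * (‖n t‖ ^ 2 + ‖b t‖ ^ 2) ≤ c * ρ t * (‖n t‖ ^ 2 + ‖b t‖ ^ 2) := by
        gcongr
      refine le_of_mul_le_mul_left ?_ hc
      nlinarith
    have h11 : L * (γ t * ‖Δ t‖) ^ 2 ≤ c / 8 * (γ t * ‖Δ t‖ ^ 2) := by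
      calc L * (γ t * ‖Δ t‖) ^ 2 = L * γ t * (γ t * ‖Δ t‖ ^ 2) := by ring
        _ ≤ _ := by gcongr
    have h12 : ‖b (t + 1)‖ ^ 2 ≤ (1 - ρ t) * ‖b t‖ ^ 2 + c / 8 * (γ t * ‖Δ t‖ ^ 2) := by
      have h13 : ‖g (x t) - g (x (t + 1))‖ ≤ L * (γ t * ‖Δ t‖) := by
        have := hL.norm_sub_le (hx t) (hx (t + 1))
        rwa [norm_sub_rev (x t), hstep, norm_smul, Real.norm_of_nonneg hγt] at this
      have h14 : 0 ≤ 1 - ρ t := sub_nonneg.2 (hρ t).2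
      have h15 : ‖b (t + 1)‖ ≤ (1 - ρ t) * (‖b t‖ + L * (γ t * ‖Δ t‖)) := by
        rw [hb, norm_smul, Real.norm_of_nonneg h14]
        gcongr
        exact (norm_add_le _ _).trans (by gcongr)
      refine (pow_le_pow_left₀ (norm_nonneg _) h15 2).trans
        ((sq_one_sub_mul_add_le (hρ t) (norm_nonneg _) (by positivity)).trans ?_)
      have h16 : (L * (γ t * ‖Δ t‖)) ^ 2 / ρ t =
          (L : ℝ) ^ 2 * (γ t / ρ t) * (γ t * ‖Δ t‖ ^ 2) := by ring
      rw [h16]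
      gcongr
    linarith
  exact (summable_mul_left_iff (by positivity)).1 key

end Lyapunov

/-! ### Analysis of a single run. -/

namespace StochSCA

variable {N M : ℕ} {E : Fin N → Type*} [∀ i, NormedAddCommGroup (E i)] {Ξ : Type*}
  {X : ∀ i, Set (E i)}

theorem norm_le_sum_norm_apply (v : Joint E) : ‖v‖ ≤ ∑ i, ‖v i‖ := by
  refine le_of_sq_le_sq ?_ (Finset.sum_nonneg fun i _ => norm_nonneg _)
  rw [PiLp.norm_sq_eq_of_L2]
  exact Finset.sum_sq_le_sq_sum_of_nonneg fun i _ => norm_nonneg _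

theorem exists_norm_sub_le_of_mem_feasible (hX : ∀ i, IsCompact (X i)) :
    ∃ R : ℝ, 0 ≤ R ∧ ∀ y ∈ feasible X, ∀ z ∈ feasible X, ‖y - z‖ ≤ R := by
  obtain ⟨R, hR⟩ := (Metric.isBounded_iff.1 (isCompact_feasible hX).isBounded)
  refine ⟨max R 0, le_max_right _ _, fun y hy z hz => ?_⟩
  rw [← dist_eq_norm]
  exact (hR hy hz).trans (le_max_left _ _)

variable [∀ i, InnerProductSpace ℝ (E i)]
  {f : Fin M → Joint E → Ξ → ℝ} {gradf : Fin M → Joint E → Ξ → Joint E}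
  {τ : Fin N → ℝ} {γ ρ : ℕ → ℝ} {ξ : ℕ → Ξ} {C : ℕ → Fin N → Finset (Fin M)}
  {x xhat acc : ℕ → Joint E}

namespace IsRun

theorem xhat_mem_feasible (h : IsRun X f gradf τ γ ρ ξ C x xhat acc) (t : ℕ) :
    xhat t ∈ feasible X := fun i => h.best_response_mem t i

theorem step (h : IsRun X f gradf τ γ ρ ξ C x xhat acc) (t : ℕ) :
    x (t + 1) - x t = γ (t + 1) • (xhat t - x t) := by
  ext i
  simp only [PiLp.sub_apply, PiLp.smul_apply, h.update t i]
  module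

theorem mem_feasible (h : IsRun X f gradf τ γ ρ ξ C x xhat acc) (hX : ∀ i, Convex ℝ (X i))
    (t : ℕ) : x t ∈ feasible X := by
  induction t with
  | zero => exact h.init
  | succ t ih =>
    have h1 := (convex_feasible hX).add_smul_sub_mem ih (h.xhat_mem_feasible t)
      ⟨(h.gamma_mem t).1.le, (h.gamma_mem t).2⟩
    rwa [← h.step, add_sub_cancel] at h1

theorem accumulate_joint (h : IsRun X f gradf τ γ ρ ξ C x xhat acc) (t : ℕ) :
    acc (t + 1) = (1 - ρ t) • acc t + ρ t • ∑ j, gradf j (x t) (ξ t) := by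
  ext i
  rw [h.accumulate t i, pricing, Finset.sum_compl_add_sum]
  simp [WithLp.ofLp_sum]

theorem inner_acc_add_le [∀ i, CompleteSpace (E i)]
    (h : IsRun X f gradf τ γ ρ ξ C x xhat acc) (hX : ∀ i, Convex ℝ (X i))
    (hf : ∀ j s, ∀ x ∈ feasible X,
      HasGradientWithinAt (fun y => f j y s) (gradf j x s) (feasible X) x)
    {c : ℝ} (hc : ∀ i, c ≤ τ i) (t : ℕ) :
    inner ℝ (acc (t + 1)) (xhat t - x t) + c * ‖xhat t - x t‖ ^ 2 ≤ 0 := by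
  have hx := h.mem_feasible hX t
  rw [PiLp.inner_apply, PiLp.norm_sq_eq_of_L2, Finset.mul_sum, ← Finset.sum_add_distrib]
  refine Finset.sum_nonpos fun i _ => ?_
  have h1 := inner_accumulated_le_of_isMinOn (fun j => hf j (ξ t) _ hx) hx (h.rho_mem t).1.le
    (h.convex_kept t i) (h.best_response_mem t i) (h.best_response_min t i)
  rw [← h.accumulate t i] at h1
  have h2 := mul_le_mul_of_nonneg_right (hc i) (sq_nonneg ‖xhat t i - x t i‖)
  simp only [PiLp.sub_apply]
  linarith

theorem exists_best_response_residual [∀ i, CompleteSpace (E i)] {L : Fin M → Ξ → NNReal}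
    (h : IsRun X f gradf τ γ ρ ξ C x xhat acc) (hX : ∀ i, Convex ℝ (X i))
    (hf : ∀ j s, ∀ x ∈ feasible X,
      HasGradientWithinAt (fun y => f j y s) (gradf j x s) (feasible X) x)
    (hL : ∀ j s, LipschitzOnWith (L j s) (fun x => gradf j x s) (feasible X))
    {R : ℝ} (hR : ∀ y ∈ feasible X, ∀ z ∈ feasible X, ‖y - z‖ ≤ R) (t : ℕ) (i : Fin N) :
    ∃ r : E i, ‖r‖ ≤ (ρ t * ∑ j, (L j (ξ t) : ℝ)) * R ∧ ∀ y ∈ X i,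
      0 ≤ inner ℝ (acc (t + 1) i + r + (2 * τ i) • (xhat t i - x t i)) (y - xhat t i) := by
  have hx := h.mem_feasible hX t
  have hρ := (h.rho_mem t).1.le
  refine ⟨ρ t • ∑ j ∈ C t i, (gradf j (withBlock (x t) i (xhat t i)) (ξ t) i
    - gradf j (x t) (ξ t) i), ?_, fun y hy => ?_⟩
  · rw [norm_smul, Real.norm_of_nonneg hρ, mul_assoc]
    gcongr
    refine (norm_sum_gradf_withBlock_sub_le (fun j => hL j (ξ t)) hx
      (h.best_response_mem t i)).trans ?_
    gcongr
    exact (PiLp.norm_apply_le (xhat t - x t) i).trans (hR _ (h.xhat_mem_feasible t) _ hx)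
  · rw [h.accumulate t i]
    exact inner_nonneg_of_isMinOn_approx (hX i) (fun j => hf j (ξ t)) hx
      (h.best_response_mem t i) (h.best_response_min t i) hy

end IsRun

/-- In each block `xhat` solves a variational inequality with linear part `acc + r - 2τ x`, so
stability of its solutions applies. The proximal centre contributes the `+ 1`, and summing the block
norms gives the factor `N`. -/
theorem norm_xhat_sub_xhat_le {g : Joint E → Joint E} {L : NNReal} {c : ℝ} {ε : ℕ → ℝ}
    (hL : LipschitzOnWith L g (feasible X)) (hc0 : 0 < c)
    (hc : ∀ i, c ≤ τ i) (hx : ∀ t, x t ∈ feasible X) (hxhat : ∀ t, xhat t ∈ feasible X)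
    (hres : ∀ t i, ∃ r : E i, ‖r‖ ≤ ε t ∧ ∀ y ∈ X i,
      0 ≤ inner ℝ (acc (t + 1) i + r + (2 * τ i) • (xhat t i - x t i)) (y - xhat t i))
    (s t : ℕ) :
    ‖xhat s - xhat t‖ ≤ N * (((2 * c)⁻¹ * L + 1) * ‖x s - x t‖)
      + N * (2 * c)⁻¹ * (‖acc (s + 1) - g (x s)‖ + ε s)
      + N * (2 * c)⁻¹ * (‖acc (t + 1) - g (x t)‖ + ε t) := by
  have hblock : ∀ i, ‖(xhat s - xhat t) i‖ ≤ ((2 * c)⁻¹ * L + 1) * ‖x s - x t‖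
      + (2 * c)⁻¹ * (‖acc (s + 1) - g (x s)‖ + ε s)
      + (2 * c)⁻¹ * (‖acc (t + 1) - g (x t)‖ + ε t) := by
    intro i
    obtain ⟨r, hr, hrs⟩ := hres s i
    obtain ⟨q, hq, hqt⟩ := hres t i
    have hτ : 0 < τ i := hc0.trans_le (hc i)
    have h1 := norm_sub_le_of_variational_inequality hτ
      (g := acc (s + 1) i + r - (2 * τ i) • x s i) (g' := acc (t + 1) i + q - (2 * τ i) • x t i)
      (p := xhat s i) (q := xhat t i)
      (by convert hrs _ (hxhat t i) using 2; module)
      (by convert hqt _ (hxhat s i) using 2; module)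
    have h2 : acc (s + 1) i + r - (2 * τ i) • x s i - (acc (t + 1) i + q - (2 * τ i) • x t i) =
        (g (x s) - g (x t)) i + (acc (s + 1) - g (x s)) i - (acc (t + 1) - g (x t)) i + r - q
        - (2 * τ i) • (x s - x t) i := by
      simp only [PiLp.sub_apply]; module
    have h3 : ‖acc (s + 1) i + r - (2 * τ i) • x s i - (acc (t + 1) i + q - (2 * τ i) • x t i)‖ ≤
        L * ‖x s - x t‖ + ‖acc (s + 1) - g (x s)‖ + ‖acc (t + 1) - g (x t)‖ + ε s + ε t
        + 2 * τ i * ‖x s - x t‖ := by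
      rw [h2]
      refine (norm_sub_le _ _).trans (add_le_add ((norm_sub_le _ _).trans (add_le_add
        ((norm_add_le _ _).trans (add_le_add ((norm_sub_le _ _).trans (add_le_add
        ((norm_add_le _ _).trans (add_le_add ?_ ?_)) ?_)) hr)) hq)) ?_)
      · exact (PiLp.norm_apply_le _ i).trans (hL.norm_sub_le (hx s) (hx t))
      · exact PiLp.norm_apply_le _ i
      · exact PiLp.norm_apply_le _ i
      · rw [norm_smul, Real.norm_of_nonneg (by positivity)]
        gcongr
        exact PiLp.norm_apply_le _ i
    have hε : ∀ t, 0 ≤ ε t := fun t => by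
      obtain ⟨r, hr, -⟩ := hres t i
      exact (norm_nonneg r).trans hr
    have h4 : (2 * τ i)⁻¹ ≤ (2 * c)⁻¹ := by gcongr; exact hc i
    have h5 : (2 * τ i)⁻¹ * (2 * τ i) = 1 := inv_mul_cancel₀ (by positivity)
    have hεs := hε s
    have hεt := hε t
    calc ‖(xhat s - xhat t) i‖ ≤ (2 * τ i)⁻¹ * (L * ‖x s - x t‖ + ‖acc (s + 1) - g (x s)‖
          + ‖acc (t + 1) - g (x t)‖ + ε s + ε t + 2 * τ i * ‖x s - x t‖) :=
          h1.trans (by gcongr)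
      _ = (2 * τ i)⁻¹ * (L * ‖x s - x t‖ + ‖acc (s + 1) - g (x s)‖
          + ‖acc (t + 1) - g (x t)‖ + ε s + ε t) + ‖x s - x t‖ := by
        rw [mul_add, ← mul_assoc, h5, one_mul]
      _ ≤ (2 * c)⁻¹ * (L * ‖x s - x t‖ + ‖acc (s + 1) - g (x s)‖
          + ‖acc (t + 1) - g (x t)‖ + ε s + ε t) + ‖x s - x t‖ := by gcongr
      _ = _ := by ring
  refine (norm_le_sum_norm_apply _).trans ((Finset.sum_le_card_nsmul _ _ _ fun i _ =>
    hblock i).trans_eq ?_)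
  simp only [Finset.card_univ, Fintype.card_fin, nsmul_eq_mul]
  ring

/-- The optimality condition holds at `xhat` with `acc`; moving the base point to `x` costs `G‖Δ‖`,
and replacing `acc` by the gradient costs the tracking error times the diameter. -/
theorem le_inner_gradient {g : Joint E → Joint E} {R G : ℝ} {ε : ℕ → ℝ}
    (hR : ∀ y ∈ feasible X, ∀ z ∈ feasible X, ‖y - z‖ ≤ R)
    (hG : ∀ y ∈ feasible X, ‖g y‖ ≤ G) (hτ : ∀ i, 0 < τ i)
    (hx : ∀ t, x t ∈ feasible X) (hxhat : ∀ t, xhat t ∈ feasible X)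
    (hres : ∀ t i, ∃ r : E i, ‖r‖ ≤ ε t ∧ ∀ y ∈ X i,
      0 ≤ inner ℝ (acc (t + 1) i + r + (2 * τ i) • (xhat t i - x t i)) (y - xhat t i))
    {y : Joint E} (hy : y ∈ feasible X) (t : ℕ) :
    -∑ i, (G * ‖xhat t - x t‖ + (‖acc (t + 1) - g (x t)‖ + ε t
      + 2 * τ i * ‖xhat t - x t‖) * R) ≤ inner ℝ (g (x t)) (y - x t) := by
  rw [PiLp.inner_apply, ← Finset.sum_neg_distrib]
  refine Finset.sum_le_sum fun i _ => ?_
  obtain ⟨r, hr, hrt⟩ := hres t i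
  have h1 := hrt _ (hy i)
  set w : E i := (acc (t + 1) - g (x t)) i + r + (2 * τ i) • (xhat t - x t) i with hw
  have h2 : acc (t + 1) i + r + (2 * τ i) • (xhat t i - x t i) = g (x t) i + w := by
    simp only [hw, PiLp.sub_apply]; abel
  have hτi := hτ i
  have h3 : ‖w‖ ≤ ‖acc (t + 1) - g (x t)‖ + ε t + 2 * τ i * ‖xhat t - x t‖ := by
    refine (norm_add_le _ _).trans (add_le_add ((norm_add_le _ _).trans (add_le_add
      (PiLp.norm_apply_le _ i) hr)) ?_)
    rw [norm_smul, Real.norm_of_nonneg (by positivity)]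
    gcongr
    exact PiLp.norm_apply_le _ i
  have h4 : inner ℝ w (y i - xhat t i) ≤ (‖acc (t + 1) - g (x t)‖ + ε t
      + 2 * τ i * ‖xhat t - x t‖) * R :=
    (real_inner_le_norm _ _).trans (mul_le_mul h3
      ((PiLp.norm_apply_le (y - xhat t) i).trans (hR _ hy _ (hxhat t))) (norm_nonneg _)
      ((norm_nonneg _).trans h3))
  have h5 : -(G * ‖xhat t - x t‖) ≤ inner ℝ (g (x t) i) (xhat t i - x t i) := by
    refine (neg_le_neg ?_).trans (abs_le.1 (abs_real_inner_le_norm _ _)).1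
    exact mul_le_mul ((PiLp.norm_apply_le _ i).trans (hG _ (hx t)))
      (PiLp.norm_apply_le (xhat t - x t) i) (norm_nonneg _)
      ((norm_nonneg _).trans (hG _ (hx t)))
  rw [h2, inner_add_left] at h1
  have h6 : inner ℝ (g (x t) i) (y i - x t i) = inner ℝ (g (x t) i) (y i - xhat t i)
      + inner ℝ (g (x t) i) (xhat t i - x t i) := by
    rw [← inner_add_right]; congr 1; abel
  simp only [PiLp.sub_apply]
  linarith

set_option maxHeartbeats 1000000 in
theorem IsRun.stationary_of_mapClusterPt [∀ i, CompleteSpace (E i)] {U : Joint E → ℝ}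
    {gradU : Joint E → Joint E} {L : Fin M → Ξ → NNReal} {LU : NNReal} {a : ℕ → Joint E}
    (h : IsRun X f gradf τ γ ρ ξ C x xhat acc)
    (hX_compact : ∀ i, IsCompact (X i)) (hX : ∀ i, Convex ℝ (X i))
    (hf : ∀ j s, ∀ x ∈ feasible X,
      HasGradientWithinAt (fun y => f j y s) (gradf j x s) (feasible X) x)
    (hL : ∀ j s, LipschitzOnWith (L j s) (fun x => gradf j x s) (feasible X))
    (hU : ∀ x ∈ feasible X, HasGradientWithinAt U (gradU x) (feasible X) x)
    (hLU : LipschitzOnWith LU gradU (feasible X)) (hτ : ∀ i, 0 < τ i)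
    (hγ : Tendsto γ atTop (𝓝 0))
    (hγs : Tendsto (fun n => ∑ t ∈ Finset.range n, γ t) atTop atTop)
    (hρs : Tendsto (fun n => ∑ t ∈ Finset.range n, ρ t) atTop atTop)
    (hγρ : Tendsto (fun t => γ t / ρ t) atTop (𝓝 0))
    (hρL : Tendsto (fun t => ρ t * ∑ j, (L j (ξ t) : ℝ)) atTop (𝓝 0))
    (ha : ∀ t, a (t + 1) = (1 - ρ t) • a t - ρ t • gradError gradf gradU (x t) (ξ t))
    (has : Summable fun t => ρ t * ‖a t‖ ^ 2) (ha0 : Tendsto a atTop (𝓝 0)) :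
    ∀ z, MapClusterPt z atTop x → IsStationary (feasible X) gradU z := by
  have hx := h.mem_feasible hX
  have hxhat := h.xhat_mem_feasible
  obtain ⟨R, hR0, hR⟩ := exists_norm_sub_le_of_mem_feasible hX_compact
  obtain ⟨c, hc0, hc⟩ : ∃ c : ℝ, 0 < c ∧ ∀ i, c ≤ τ i := by
    obtain ⟨c, hc0, hc⟩ := Pi.exists_forall_pos_add_lt (x := 0) (y := τ) hτ
    exact ⟨c, hc0, fun i => by simpa using (hc i).le⟩
  -- The move out of `x t` uses `γ (t + 1)`, and the error of `acc (t + 1)` at `x t` is next damped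
  -- by `ρ (t + 1)`; both stepsizes are shifted by one.
  have hshift : ∀ {u : ℕ → ℝ}, Tendsto (fun n => ∑ t ∈ Finset.range n, u t) atTop atTop →
      Tendsto (fun n => ∑ t ∈ Finset.range n, u (t + 1)) atTop atTop := fun {u} hu => by
    have h1 := tendsto_atTop_add_const_right _ (-u 0) ((tendsto_add_atTop_iff_nat 1).2 hu)
    refine h1.congr fun n => ?_
    rw [Finset.sum_range_succ']; ring
  set Δ : ℕ → Joint E := fun t => xhat t - x t with hΔ
  -- Subtracting `a (t + 1)` removes the samples: the recursion of `b` involves only increments of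
  -- `gradU`.
  set b : ℕ → Joint E := fun t => acc (t + 1) - gradU (x t) - a (t + 1) with hb
  have hΔR : ∀ t, ‖Δ t‖ ≤ R := fun t => hR _ (hxhat t) _ (hx t)
  have hγ0 : ∀ t, 0 ≤ γ (t + 1) := fun t => (h.gamma_mem t).1.le
  have hρ1 : ∀ t, ρ (t + 1) ∈ Ioc (0 : ℝ) 1 := fun t => h.rho_mem (t + 1)
  have hγ1 := (tendsto_add_atTop_iff_nat 1).2 hγ
  have hγρ1 := (tendsto_add_atTop_iff_nat 1).2 hγρ
  have hbrec : ∀ t, b (t + 1) = (1 - ρ (t + 1)) • (b t + (gradU (x t) - gradU (x (t + 1)))) :=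
    fun t => by
      simp only [hb, ha (t + 1), h.accumulate_joint (t + 1), gradError]
      module
  have hb0 : Tendsto b atTop (𝓝 0) :=
    tendsto_zero_of_tracking hLU hx h.step hΔR hγ0 hρ1 (hshift hρs) hγρ1 hbrec
  have hcont : ContinuousOn U (feasible X) := fun y hy =>
    (hU y hy).differentiableWithinAt.continuousWithinAt
  obtain ⟨m, hm⟩ : ∃ m, ∀ y ∈ feasible X, m ≤ U y := by
    obtain ⟨y, hy, hmin⟩ := (isCompact_feasible hX_compact).exists_isMinOn ⟨_, hx 0⟩ hcont
    exact ⟨U y, fun z hz => hmin hz⟩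
  obtain ⟨G, hG⟩ := (isCompact_feasible hX_compact).exists_bound_of_continuousOn
    hLU.continuousOn
  have hsum : Summable fun t => γ (t + 1) * ‖Δ t‖ ^ 2 :=
    summable_mul_norm_sq_of_descent (convex_feasible hX) hU hLU hm hc0 hx h.step hγ0 hρ1 hγ1 hγρ1
      (a := fun t => acc (t + 1)) (n := fun t => a (t + 1)) (fun t => by simp only [hb]; abel)
      hbrec ((summable_nat_add_iff 1).2 has) (h.inner_acc_add_le hX hf hc)
  have hd0 : Tendsto (fun t => ‖acc (t + 1) - gradU (x t)‖) atTop (𝓝 0) := by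
    have ha1 : Tendsto (fun t => a (t + 1)) atTop (𝓝 0) := (tendsto_add_atTop_iff_nat 1).2 ha0
    have hd : Tendsto (fun t => b t + a (t + 1)) atTop (𝓝 (0 + 0)) := hb0.add ha1
    rw [add_zero] at hd
    refine (tendsto_zero_iff_norm_tendsto_zero.1 hd).congr fun t => ?_
    simp only [hb, sub_add_cancel]
  have hres := h.exists_best_response_residual hX hf hL hR
  set ε : ℕ → ℝ := fun t => (ρ t * ∑ j, (L j (ξ t) : ℝ)) * R with hε
  have hε0 : Tendsto ε atTop (𝓝 0) := by simpa using hρL.mul_const R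
  have hpath : ∀ s t, s ≤ t → ‖x s - x t‖ ≤ R * ∑ r ∈ Finset.Ico s t, γ (r + 1) := by
    intro s t hst
    rw [← dist_eq_norm, Finset.mul_sum]
    refine dist_le_Ico_sum_of_dist_le hst fun {r} _ _ => ?_
    rw [dist_comm, dist_eq_norm, h.step, norm_smul, Real.norm_of_nonneg (hγ0 r), mul_comm]
    exact mul_le_mul_of_nonneg_right (hΔR r) (hγ0 r)
  have hΔ0 : Tendsto (fun t => ‖Δ t‖) atTop (𝓝 0) := by
    refine tendsto_zero_of_summable_mul_sq
      -- The extra `+ 1` accounts for `x s - x t` itself in `Δ s - Δ t`.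
      (K := (N * ((2 * c)⁻¹ * LU + 1) + 1) * R)
      (η := fun t => N * (2 * c)⁻¹ * (‖acc (t + 1) - gradU (x t)‖ + ε t))
      (by positivity) hγ0 (hshift hγs) (fun t => norm_nonneg _) hsum
      (by simpa using (hd0.add hε0).const_mul (N * (2 * c)⁻¹)) fun s t hst => ?_
    have h1 : Δ s = Δ t + (xhat s - xhat t) - (x s - x t) := by simp only [hΔ]; abel
    have h2 := norm_xhat_sub_xhat_le hLU hc0 hc hx hxhat hres s t
    have h3 : ‖Δ s‖ ≤ ‖Δ t‖ + ‖xhat s - xhat t‖ + ‖x s - x t‖ := by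
      rw [h1]
      exact (norm_sub_le _ _).trans (by gcongr; exact norm_add_le _ _)
    have h4 : (N * ((2 * c)⁻¹ * LU + 1) + 1) * ‖x s - x t‖ ≤
        (N * ((2 * c)⁻¹ * LU + 1) + 1) * (R * ∑ r ∈ Finset.Ico s t, γ (r + 1)) := by
      gcongr
      exact hpath s t hst
    linarith
  intro z hz
  obtain ⟨φ, hφ, hφz⟩ := hz.tendsto_subseq
  have hzX : z ∈ feasible X := (isCompact_feasible hX_compact).isClosed.mem_of_tendsto hφz
    (Eventually.of_forall fun k => hx _)
  refine ⟨hzX, fun y hy => ?_⟩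
  have h1 : Tendsto (fun k => inner ℝ (gradU (x (φ k))) (y - x (φ k))) atTop
      (𝓝 (inner ℝ (gradU z) (y - z))) :=
    ((hLU.continuousOn z hzX).tendsto.comp (tendsto_nhdsWithin_iff.2
      ⟨hφz, Eventually.of_forall fun k => hx _⟩)).inner (tendsto_const_nhds.sub hφz)
  have h2 : Tendsto (fun t => -∑ i, (G * ‖Δ t‖ + (‖acc (t + 1) - gradU (x t)‖ + ε t
      + 2 * τ i * ‖Δ t‖) * R)) atTop (𝓝 0) := by
    have h3 : ∀ i ∈ Finset.univ, Tendsto (fun t => G * ‖Δ t‖ + (‖acc (t + 1) - gradU (x t)‖ + ε t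
      + 2 * τ i * ‖Δ t‖) * R) atTop (𝓝 0) := fun i _ => by
      simpa using (hΔ0.const_mul G).add
        (((hd0.add hε0).add (hΔ0.const_mul (2 * τ i))).mul_const R)
    simpa using (tendsto_finsetSum _ h3).neg
  exact le_of_tendsto_of_tendsto' (h2.comp hφ.tendsto_atTop) h1 fun k =>
    le_inner_gradient hR hG hτ hx hxhat hres hy (φ k)

end StochSCA

/-! ### Measurability with respect to the history, and the almost sure conclusion. -/

namespace StochSCA

section History

variable {Ω H Ξ : Type*} [MeasurableSpace H] [MeasurableSpace Ξ]
  {x : ℕ → Ω → H} {ξ : ℕ → Ω → Ξ} {γ ρ : ℕ → Ω → ℝ}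

/-- The histories as a filtration. -/
def historyFiltration [mΩ : MeasurableSpace Ω] (hx : ∀ t, Measurable (x t)) (hξ : ∀ t, Measurable (ξ t))
    (hγ : ∀ t, Measurable (γ t)) (hρ : ∀ t, Measurable (ρ t)) : Filtration ℕ mΩ where
  seq := history x ξ γ ρ
  mono' := fun s t hst => by
    refine sup_le_sup (sup_le_sup (sup_le_sup ?_ ?_) ?_) ?_
    · exact biSup_mono fun r hr => lt_of_lt_of_le hr hst
    · exact biSup_mono fun r hr => lt_of_lt_of_le hr hst
    · exact biSup_mono fun r hr => ⟨hr.1, hr.2.trans hst⟩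
    · exact biSup_mono fun r hr => le_trans hr hst
  le' := fun t => sup_le (sup_le (sup_le (iSup₂_le fun s _ => (hx s).comap_le)
    (iSup₂_le fun s _ => (hξ s).comap_le)) (iSup₂_le fun s _ => (hγ s).comap_le))
    (iSup₂_le fun s _ => (hρ s).comap_le)

theorem measurable_history_x {s t : ℕ} (hst : s < t) : Measurable[history x ξ γ ρ t] (x s) :=
  measurable_iff_comap_le.2 (le_sup_of_le_left (le_sup_of_le_left (le_sup_of_le_left
    (le_iSup₂_of_le s hst le_rfl))))

theorem measurable_history_sample {s t : ℕ} (hst : s < t) :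
    Measurable[history x ξ γ ρ t] (ξ s) :=
  measurable_iff_comap_le.2 (le_sup_of_le_left (le_sup_of_le_left (le_sup_of_le_right
    (le_iSup₂_of_le s hst le_rfl))))

theorem measurable_history_rho (t : ℕ) : Measurable[history x ξ γ ρ t] (ρ t) :=
  measurable_iff_comap_le.2 (le_sup_of_le_right (le_iSup₂_of_le t (mem_Iic.2 le_rfl) le_rfl))

end History

/-- Carathéodory functions are jointly measurable. Continuity is available only on `K`, so the
argument is run on the subtype, where `x` takes its values. -/
theorem measurable_comp_of_continuousOn {Ω H G Ξ : Type*} {m : MeasurableSpace Ω}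
    [TopologicalSpace H] [TopologicalSpace.MetrizableSpace H] [SecondCountableTopology H]
    [MeasurableSpace H] [BorelSpace H] [MeasurableSpace Ξ]
    [TopologicalSpace G] [TopologicalSpace.PseudoMetrizableSpace G] [MeasurableSpace G]
    [BorelSpace G] {K : Set H} {g : H → Ξ → G} (hc : ∀ s, ContinuousOn (fun x => g x s) K)
    (hm : ∀ x ∈ K, Measurable (g x)) {x : Ω → H} {ξ : Ω → Ξ} (hx : Measurable x)
    (hξ : Measurable ξ) (hxK : ∀ ω, x ω ∈ K) : Measurable fun ω => g (x ω) (ξ ω) := by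
  have h1 : Measurable (Function.uncurry fun (p : K) (s : Ξ) => g p s) :=
    measurable_uncurry_of_continuous_of_measurable
      (fun s => continuousOn_iff_continuous_domRestrict.1 (hc s)) fun p => hm p p.2
  exact h1.comp ((hx.subtype_mk (h := hxK)).prodMk hξ)

end StochSCA

theorem theorem1 {N M : ℕ} {E : Fin N → Type*}
    [∀ i, NormedAddCommGroup (E i)] [∀ i, InnerProductSpace ℝ (E i)]
    [∀ i, FiniteDimensional ℝ (E i)] [∀ i, MeasurableSpace (E i)] [∀ i, BorelSpace (E i)]
    {Ξ : Type*} [MeasurableSpace Ξ] (ν : Measure Ξ) [IsProbabilityMeasure ν]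
    {Ω : Type*} [MeasurableSpace Ω] (P : Measure Ω) [IsProbabilityMeasure P]
    -- the problem: feasible sets, sample functions and their gradients
    (X : ∀ i, Set (E i))
    (f : Fin M → StochSCA.Joint E → Ξ → ℝ)
    (gradf : Fin M → StochSCA.Joint E → Ξ → StochSCA.Joint E)
    (gradU : StochSCA.Joint E → StochSCA.Joint E)
    (L : Fin M → Ξ → NNReal) (LU : NNReal)
    -- (a)
    (hX_compact : ∀ i, IsCompact (X i)) (hX_convex : ∀ i, Convex ℝ (X i))
    -- (b)
    (hf_grad : ∀ j s, ∀ x ∈ StochSCA.feasible X,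
      HasGradientWithinAt (fun y => f j y s) (gradf j x s) (StochSCA.feasible X) x)
    (hf_lip : ∀ j s, LipschitzOnWith (L j s) (fun x => gradf j x s) (StochSCA.feasible X))
    (hf_int : ∀ x ∈ StochSCA.feasible X, Integrable (fun s => ∑ j, f j x s) ν)
    (hgradf_meas : ∀ j, ∀ x ∈ StochSCA.feasible X, Measurable (gradf j x))
    (hU_grad : ∀ x ∈ StochSCA.feasible X,
      HasGradientWithinAt (StochSCA.objective ν f) (gradU x) (StochSCA.feasible X) x)
    (hU_lip : LipschitzOnWith LU gradU (StochSCA.feasible X))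
    -- the algorithm
    (τ : Fin N → ℝ) (hτ : ∀ i, 0 < τ i)
    (γ ρ : ℕ → Ω → ℝ) (hγ_meas : ∀ t, Measurable (γ t)) (hρ_meas : ∀ t, Measurable (ρ t))
    (ξ : ℕ → Ω → Ξ) (hξ_meas : ∀ t, Measurable (ξ t))
    (C : ℕ → Fin N → Ω → Finset (Fin M))
    (x xhat acc : ℕ → Ω → StochSCA.Joint E) (hx_meas : ∀ t, Measurable (x t))
    (hrun : ∀ ω, StochSCA.IsRun X f gradf τ (fun t => γ t ω) (fun t => ρ t ω) (fun t => ξ t ω)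
      (fun t i => C t i ω) (fun t => x t ω) (fun t => xhat t ω) (fun t => acc t ω))
    -- (c)
    (herr_sq : ∀ t, MemLp (fun ω => StochSCA.gradError gradf gradU (x t ω) (ξ t ω)) 2 P)
    (herr_unbiased : ∀ t,
      P[fun ω => StochSCA.gradError gradf gradU (x t ω) (ξ t ω) | StochSCA.history x ξ γ ρ t]
        =ᵐ[P] 0)
    (herr_var : ∀ᵐ ω ∂P, ∃ B : ℝ, ∀ t,
      (P[fun ω' => ‖StochSCA.gradError gradf gradU (x t ω') (ξ t ω')‖ ^ 2 |
        StochSCA.history x ξ γ ρ t]) ω ≤ B)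
    -- i)
    (hγ : ∀ᵐ ω ∂P, Tendsto (fun t => γ t ω) atTop (𝓝 0) ∧
      Tendsto (fun n => ∑ t ∈ Finset.range n, γ t ω) atTop atTop ∧
      Summable (fun t => γ t ω ^ 2))
    -- ii)
    (hρ : ∀ᵐ ω ∂P, Tendsto (fun t => ρ t ω) atTop (𝓝 0) ∧
      Tendsto (fun n => ∑ t ∈ Finset.range n, ρ t ω) atTop atTop ∧
      Summable (fun t => ρ t ω ^ 2))
    -- iii)
    (hγρ : ∀ᵐ ω ∂P, Tendsto (fun t => γ t ω / ρ t ω) atTop (𝓝 0))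
    -- iv)
    (hρL : ∀ᵐ ω ∂P, Tendsto (fun t => ρ t ω * ∑ j, (L j (ξ t ω) : ℝ)) atTop (𝓝 0)) :
    ∀ᵐ ω ∂P,
      (∃ z, MapClusterPt z atTop (fun t => x t ω)) ∧
      ∀ z, MapClusterPt z atTop (fun t => x t ω) →
        StochSCA.IsStationary (StochSCA.feasible X) gradU z := by

  have hprob := noiseAverage_convergence (P := P)
    (𝓕 := StochSCA.historyFiltration hx_meas hξ_meas hγ_meas hρ_meas) (ρ := ρ)
    (e := fun t ω => StochSCA.gradError gradf gradU (x t ω) (ξ t ω))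
    (fun t => (StochSCA.measurable_history_rho t).stronglyMeasurable)
    (fun t ω => Ioc_subset_Icc_self ((hrun ω).rho_mem t))
    -- The error at time `t` is a function of `x t` and `ξ t`, which first enter the history at `t +
    -- 1`.
    (fun t => by
      have hx := StochSCA.measurable_history_x (x := x) (ξ := ξ) (γ := γ) (ρ := ρ) t.lt_succ_self
      have hξ := StochSCA.measurable_history_sample (x := x) (ξ := ξ) (γ := γ) (ρ := ρ)
        t.lt_succ_self
      have hxK := fun ω => (hrun ω).mem_feasible hX_convex t
      refine Measurable.stronglyMeasurable (Measurable.sub ?_ ?_)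
      · exact StochSCA.measurable_comp_of_continuousOn (g := fun y (_ : Ξ) => gradU y)
          (fun _ => hU_lip.continuousOn) (fun y _ => measurable_const) hx hξ hxK
      · exact Finset.measurable_fun_sum _ fun j _ =>
          StochSCA.measurable_comp_of_continuousOn (fun s => (hf_lip j s).continuousOn)
            (hgradf_meas j) hx hξ hxK)
    herr_sq herr_unbiased herr_var (by
      filter_upwards [hρ] with ω hω using hω.2)
  filter_upwards [hprob, hγ, hρ, hγρ, hρL] with ω ⟨hsum, hnoise⟩ hγω hρω hγρω hρLω
  refine ⟨?_, (hrun ω).stationary_of_mapClusterPt hX_compact hX_convex hf_grad hf_lip hU_grad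
    hU_lip hτ hγω.1 hγω.2.1 hρω.2.1 hγρω hρLω (fun t => rfl) hsum hnoise⟩
  obtain ⟨z, -, hz⟩ := (StochSCA.isCompact_feasible hX_compact).exists_mapClusterPt_of_frequently
    (l := atTop) (f := fun t => x t ω)
    (Frequently.of_forall fun t => (hrun ω).mem_feasible hX_convex t)
  exact ⟨z, hz⟩
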